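/- Let $L\ge 2$ be an integer, let $t,\Delta,\mu,n_c,\mathcal E_c$ be real with $\Delta\neq 0$, $\mathcal E_c\ge 0$ and $|\mu|<t$, put $E_c=\mathcal E_c/L$, and let $M\in\mathbb Z$. Let $\hat c_1,\dots,\hat c_L$ be fermion operators on the Fock space $\mathcal F$ of an open wire with $L$ sites, $\hat N_w=\sum_j \hat c_j^\dagger\hat c_j$, and let $\hat n|p\rangle=p|p\rangle$, $e^{i\hat\phi}|p\rangle=|p+1\rangle$ on the space $\ell^2(\mathbb Z)$ with orthonormal basis $|p\rangle$, $p\in\mathbb Z$. On $\mathcal F\otimes\ell^2(\mathbb Z)$ consider $$\hat H_{0,x}=-\frac t2\sum_{j=1}^{L-1}(\hat c_j^\dagger\hat c_{j+1}+\mathrm{h.c.})-\frac\Delta2\sum_{j=1}^{L-1}(\hat c_j\hat c_{j+1}e^{i\hat\phi}+\mathrm{h.c.})-x\Big(\hat N_w-\frac L2\Big),\qquad \hat H_\mu=\hat H_{0,\mu}+E_c(2\hat n-2n_c)^2 .$$ Both commute with $\hat N=\hat N_w+2\hat n$; the $M$-particle sector is the eigenspace of $\hat N$ for the eigenvalue $M$.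 Let $f^{(M)}(x)=\langle\chi|\hat N_w|\chi\rangle$, where $\chi$ is the normalized ground state of $\hat H_{0,x}$ in the $M$-particle sector. The gap of a Hamiltonian in the $M$-particle sector is the difference $E_1-E_0$ of its two lowest eigenvalues there, counted with multiplicity; let $\delta^{(M)}_{0,x}$ and $\delta^{(M)}_\mu$ be the gaps of $\hat H_{0,x}$ and of $\hat H_\mu$. Assume that $$-t+2E_cf^{(M)}(\mu)<\mu+2E_c(M-2n_c)<t+2E_cf^{(M)}(\mu).$$ Then there is a unique $\mu'\in(-t,t)$ (the shifted chemical potential) with $\mu+2E_c(M-2n_c)=\mu'+2E_cf^{(M)}(\mu')$, and for this $\mu'$: (a) if $\mathcal E_c\left(\frac12+\frac8L\right)<\delta^{(M)}_{0,\mu'}$, then $\hat H_\mu$ has a unique ground state in the $M$-particle sector, and $\delta^{(M)}_\mu\ge\delta^{(M)}_{0,\mu'}-\mathcal E_c\left(\frac12+\frac8L\right)$; (b) if $M$ is even and $\frac{\mathcal E_c}2<\delta^{(M)}_{0,\mu'}$, then $\hat H_\mu$ has a unique ground state in the $M$-particle sector, and $\delta^{(M)}_\mu\ge\delta^{(M)}_{0,\mu'}-\frac{\mathcal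 E_c}2$. -/

import Mathlib

open scoped ComplexConjugate

namespace NumberConservingWire

noncomputable section

/-- Labels `(S, p)` of the basis vectors `|S⟩ ⊗ |p⟩`: the set `S` of occupied sites of the wire
(sites `0, …, L - 1`) and the number `p` of Cooper pairs in the superconductor. -/
abbrev Config (L : ℕ) : Type := Finset (Fin L) × ℤ

/-- State vectors: finite linear combinations of the orthonormal basis vectors `|S⟩ ⊗ |p⟩` of
`(fermionic Fock space of the wire) ⊗ ℓ²(ℤ)`. All operators below preserve this dense subspace, and
it contains every vector with a definite total particle number, because for a given total number
there are only finitely many labels. -/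
abbrev State (L : ℕ) : Type := Config L →₀ ℂ

/-- Linear operators on state vectors. -/
abbrev Op (L : ℕ) : Type := Module.End ℂ (State L)

/-- The basis vector `|S⟩ ⊗ |p⟩`. -/
def ket {L : ℕ} (S : Finset (Fin L)) (p : ℤ) : State L := Finsupp.single (S, p) 1

/-- The operator with prescribed values on the basis vectors. -/
def ofBasis {L : ℕ} (F : Finset (Fin L) → ℤ → State L) : Op L :=
  Finsupp.linearCombination ℂ (fun b : Config L => F b.1 b.2)

/-- The inner product `⟨ψ|φ⟩`, conjugate-linear in `ψ`. -/
def braket {L : ℕ} (ψ φ : State L) : ℂ := ψ.sum fun b z => conj z * φ b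

/-- The fermionic sign `(-1)^{number of occupied sites to the left of j}`. -/
def fermiSign {L : ℕ} (j : Fin L) (S : Finset (Fin L)) : ℂ :=
  (-1) ^ (S.filter (fun k => k < j)).card

/-- The fermion annihilation operator `c_j`. -/
def ann {L : ℕ} (j : Fin L) : Op L :=
  ofBasis fun S p => if j ∈ S then fermiSign j S • ket (S.erase j) p else 0

/-- The fermion creation operator `c_j†`. -/
def cre {L : ℕ} (j : Fin L) : Op L :=
  ofBasis fun S p => if j ∈ S then 0 else fermiSign j S • ket (insert j S) p

/-- The number operator `N_w = ∑_j c_j† c_j` of fermions on the wire. -/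
def wireNumber (L : ℕ) : Op L := ∑ j : Fin L, cre j * ann j

/-- The Cooper pair number operator `n`: `n |p⟩ = p |p⟩`. -/
def pairNumber (L : ℕ) : Op L := ofBasis fun S p => (p : ℂ) • ket S p

/-- The operator `e^{iφ}`, which raises the number of Cooper pairs by one. -/
def phaseUp (L : ℕ) : Op L := ofBasis fun S p => ket S (p + 1)

/-- The operator `e^{-iφ}`, the inverse and adjoint of `e^{iφ}`. -/
def phaseDown (L : ℕ) : Op L := ofBasis fun S p => ket S (p - 1)

/-- The total particle number operator `N = N_w + 2 n`. -/
def totalNumber (L : ℕ) : Op L := wireNumber L + (2 : ℂ) • pairNumber L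

/-- The `M`-particle sector: all vectors `ψ` with `N ψ = M ψ`. -/
def sector (L : ℕ) (M : ℤ) : Submodule ℂ (State L) :=
  Module.End.eigenspace (totalNumber L) (M : ℂ)

/-- The number-conserving Hamiltonian without charging energy on the open wire,
`H_{0,μ} = -(t/2) ∑_j (c_j† c_{j+1} + h.c.) - (Δ/2) ∑_j (c_j c_{j+1} e^{iφ} + h.c.) - μ (N_w - L/2)`,
the sums running over the bonds `(j, j + 1)` between neighbouring sites. -/
def hamZero (L : ℕ) (t Δ μ : ℝ) : Op L :=
  -((t / 2 : ℝ) : ℂ) • (∑ i : Fin L, ∑ j : Fin L,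
      if (i : ℕ) + 1 = (j : ℕ) then cre i * ann j + cre j * ann i else 0)
  - ((Δ / 2 : ℝ) : ℂ) • (∑ i : Fin L, ∑ j : Fin L,
      if (i : ℕ) + 1 = (j : ℕ) then
        ann i * ann j * phaseUp L + phaseDown L * cre j * cre i else 0)
  - (μ : ℂ) • (wireNumber L - ((L : ℂ) / 2) • (1 : Op L))

/-- The charging energy `V = E_c (2 n - 2 n_c)²`, with `E_c = 𝓔_c / L`. -/
def charging (L : ℕ) (𝓔c nc : ℝ) : Op L :=
  ((𝓔c / L : ℝ) : ℂ) • ((2 : ℂ) • pairNumber L - ((2 * nc : ℝ) : ℂ) • (1 : Op L)) ^ 2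

/-- The full Hamiltonian `H_μ = H_{0,μ} + V`. -/
def ham (L : ℕ) (t Δ 𝓔c nc μ : ℝ) : Op L := hamZero L t Δ μ + charging L 𝓔c nc

/-- The span of the eigenvectors of `H` in the `M`-particle sector with eigenvalue at most `E`. -/
def lowSpace {L : ℕ} (H : Op L) (M : ℤ) (E : ℝ) : Submodule ℂ (State L) :=
  ⨆ x : ℝ, ⨆ _ : x ≤ E, (Module.End.eigenspace H (x : ℂ) ⊓ sector L M)

/-- The eigenvalues `E_0 ≤ E_1 ≤ …` of `H` in the `M`-particle sector, in increasing order and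
repeated according to multiplicity: `E_k` is the least `E` such that at least `k + 1` eigenvalues,
counted with multiplicity, are at most `E`. -/
def level {L : ℕ} (H : Op L) (M : ℤ) (k : ℕ) : ℝ :=
  sInf {E : ℝ | k < Module.finrank ℂ (lowSpace H M E)}

/-- The energy gap `E_1 - E_0` of `H` in the `M`-particle sector. -/
def gap {L : ℕ} (H : Op L) (M : ℤ) : ℝ := level H M 1 - level H M 0

/-- The space of ground states of `H` in the `M`-particle sector. -/
def groundSpace {L : ℕ} (H : Op L) (M : ℤ) : Submodule ℂ (State L) :=
  Module.End.eigenspace H ((level H M 0 : ℝ) : ℂ) ⊓ sector L M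

/-- `H` has a unique ground state (up to a scalar) in the `M`-particle sector. -/
def HasUniqueGroundState {L : ℕ} (H : Op L) (M : ℤ) : Prop :=
  Module.finrank ℂ (groundSpace H M) = 1

/-- A normalized ground state of `H_{0,x}` in the `M`-particle sector. -/
def groundStateZero (L : ℕ) (t Δ : ℝ) (M : ℤ) (x : ℝ) : State L :=
  Classical.epsilon fun χ => χ ∈ groundSpace (hamZero L t Δ x) M ∧ braket χ χ = 1

/-- `f^{(M)}(x) = ⟨χ|N_w|χ⟩`, where `χ` is the ground state of `H_{0,x}` in the `M`-particle
sector. -/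
def filling (L : ℕ) (t Δ : ℝ) (M : ℤ) (x : ℝ) : ℝ :=
  (braket (groundStateZero L t Δ M x) (wireNumber L (groundStateZero L t Δ M x))).re

/-- The condition
`-t + 2 E_c f^{(M)}(μ) < μ + 2 E_c (M - 2 n_c) < t + 2 E_c f^{(M)}(μ)`, with `E_c = 𝓔_c / L`. -/
def ShiftCondition (L : ℕ) (t Δ 𝓔c nc μ : ℝ) (M : ℤ) : Prop :=
  -t + 2 * (𝓔c / L) * filling L t Δ M μ < μ + 2 * (𝓔c / L) * (M - 2 * nc) ∧
    μ + 2 * (𝓔c / L) * (M - 2 * nc) < t + 2 * (𝓔c / L) * filling L t Δ M μ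

/-- `μ'` is a shifted chemical potential: `|μ'| < t` and
`μ + 2 E_c (M - 2 n_c) = μ' + 2 E_c f^{(M)}(μ')`. In the `M`-particle sector `H_μ` then equals
`H_{0,μ'} + E_c (N_w - f^{(M)}(μ'))²` up to an additive constant. -/
def IsShiftedPotential (L : ℕ) (t Δ 𝓔c nc μ : ℝ) (M : ℤ) (μ' : ℝ) : Prop :=
  |μ'| < t ∧
    μ + 2 * (𝓔c / L) * (M - 2 * nc) = μ' + 2 * (𝓔c / L) * filling L t Δ M μ'

end

end NumberConservingWire

/-! In the `M`-particle sector the pair number is determined by the wire, `2n = M - N_w`, so the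
sector is the part of the wire's Fock space with the parity of `M`, and `H_{0,x}` becomes a Kitaev
chain. Completing the square turns `H_μ` into `H_{0,μ'} + E_c (N_w - f)²` plus a constant, where `f`
is the filling at `μ'`. The square is nonnegative, so by min-max the second level rises by at least
that constant; the ground state of `H_{0,μ'}` is a trial state for the lowest level, whose excess
over the constant is at most `E_c` times the variance of `N_w`. Hence the gap shrinks by at most
`E_c · Var(N_w)` (`gap_sub_le_gap`).

The variance is at most `L/2` (`IsGround.norm_number_sub_sq_le`), which gives the loss `𝓔c/2`. A
singular value decomposition of the couplings splits the chain into commuting modes `α_k β_k`. A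
Perron–Frobenius argument makes the ground state of fixed parity unique (`IsGround.exists_eq_smul`),
so it is an eigenvector of every mode. In such a state the vectors `α_k α_l ψ` are orthonormal up to
antisymmetry, and `2 N_w - L = ∑ a_i b_i` has an orthogonal matrix in the modes; this bounds its
fluctuations. The argument runs in either parity sector, and the weaker loss in (a) follows.

For `μ'`, the map `x ↦ x + 2 E_c f(x)` is strictly increasing and continuous: `f` is monotone by the
variational principle and continuous by compactness together with uniqueness of the ground state. -/

namespace NumberConservingWire

noncomputable section

/-! ### Levels of symmetric operators and min-max estimates -/

section Spectral

variable {E : Type*} [NormedAddCommGroup E] [InnerProductSpace ℂ E]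

/-- The span of the eigenvectors of `T` with eigenvalue at most `x`. -/
def lowSpan (T : E →ₗ[ℂ] E) (x : ℝ) : Submodule ℂ E :=
  ⨆ y : ℝ, ⨆ _ : y ≤ x, Module.End.eigenspace T (y : ℂ)

/-- The `k`-th eigenvalue of `T`, in increasing order and counted with multiplicity. -/
def spectralLevel (T : E →ₗ[ℂ] E) (k : ℕ) : ℝ :=
  sInf {x : ℝ | k < Module.finrank ℂ (lowSpan T x)}

theorem norm_sq_eq_sum_repr {ι : Type*} [Fintype ι] (b : OrthonormalBasis ι ℂ E) (v : E) :
    ‖v‖ ^ 2 = ∑ i, ‖b.repr v i‖ ^ 2 := by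
  rw [← b.repr.norm_map, EuclideanSpace.norm_sq_eq]

theorem eigenspace_le_lowSpan (T : E →ₗ[ℂ] E) {x y : ℝ} (h : y ≤ x) :
    Module.End.eigenspace T (y : ℂ) ≤ lowSpan T x :=
  le_iSup₂_of_le y h le_rfl

variable [FiniteDimensional ℂ E] {T : E →ₗ[ℂ] E}

theorem inner_apply_eq_sum (hT : T.IsSymmetric) (v : E) :
    (inner ℂ v (T v)).re = ∑ i, hT.eigenvalues rfl i * ‖(hT.eigenvectorBasis rfl).repr v i‖ ^ 2 := by
  rw [← (hT.eigenvectorBasis rfl).repr.inner_map_map, PiLp.inner_apply, Complex.re_sum]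
  refine Finset.sum_congr rfl fun i _ => ?_
  rw [hT.eigenvectorBasis_apply_self_apply, RCLike.inner_apply, mul_assoc, Complex.mul_conj,
    Complex.normSq_eq_norm_sq]
  exact Complex.re_ofReal_mul _ _

theorem repr_eq_zero_of_mem_lowSpan (hT : T.IsSymmetric) {x : ℝ} {v : E} (hv : v ∈ lowSpan T x)
    {i : Fin (Module.finrank ℂ E)} (hi : x < hT.eigenvalues rfl i) :
    (hT.eigenvectorBasis rfl).repr v i = 0 := by
  have hle : lowSpan T x ≤
      LinearMap.ker (innerSL ℂ (hT.eigenvectorBasis rfl i) : E →ₗ[ℂ] ℂ) := by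
    refine iSup_le fun y => iSup_le fun hy w hw => ?_
    have hw' : T w = (y : ℂ) • w := Module.End.mem_eigenspace_iff.mp hw
    have h := hT (hT.eigenvectorBasis rfl i) w
    rw [hT.apply_eigenvectorBasis, hw', inner_smul_left, inner_smul_right] at h
    have h2 : ((hT.eigenvalues rfl i : ℂ) - y) * inner ℂ (hT.eigenvectorBasis rfl i) w = 0 := by
      rw [sub_mul, ← h]; simp
    rcases mul_eq_zero.mp h2 with h3 | h3
    · have : hT.eigenvalues rfl i = y := by exact_mod_cast sub_eq_zero.mp h3
      linarith
    · simpa using h3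
  rw [OrthonormalBasis.repr_apply_apply]
  simpa using hle hv

theorem inner_le_of_mem_lowSpan (hT : T.IsSymmetric) {x : ℝ} {v : E} (hv : v ∈ lowSpan T x) :
    (inner ℂ v (T v)).re ≤ x * ‖v‖ ^ 2 := by
  rw [inner_apply_eq_sum hT, norm_sq_eq_sum_repr (hT.eigenvectorBasis rfl), Finset.mul_sum]
  refine Finset.sum_le_sum fun i _ => ?_
  rcases lt_or_ge x (hT.eigenvalues rfl i) with h | h
  · simp [repr_eq_zero_of_mem_lowSpan hT hv h]
  · gcongr

theorem eigenvectorBasis_mem_lowSpan (hT : T.IsSymmetric) {x : ℝ} {i : Fin (Module.finrank ℂ E)}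
    (hi : hT.eigenvalues rfl i ≤ x) : hT.eigenvectorBasis rfl i ∈ lowSpan T x :=
  eigenspace_le_lowSpan T hi
    (Module.End.mem_eigenspace_iff.mpr (hT.apply_eigenvectorBasis rfl i))

theorem lowSpan_eq_bot (hT : T.IsSymmetric) {x : ℝ} (hx : ∀ i, x < hT.eigenvalues rfl i) :
    lowSpan T x = ⊥ := by
  rw [eq_bot_iff]
  intro v hv
  rw [Submodule.mem_bot, ← (hT.eigenvectorBasis rfl).repr.map_eq_zero_iff]
  ext i
  simpa using repr_eq_zero_of_mem_lowSpan hT hv (hx i)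

/-- The infimum of a real set that is unbounded below is the default value `0`; this and
`exists_lowSpan_eq_top`, which supplies nonemptiness, make the infimum in `spectralLevel`
meaningful. -/
theorem bddBelow_levelSet (hT : T.IsSymmetric) (k : ℕ) :
    BddBelow {x : ℝ | k < Module.finrank ℂ (lowSpan T x)} := by
  obtain ⟨c, hc⟩ := (Set.finite_range (hT.eigenvalues rfl)).bddBelow
  refine ⟨c, fun x hx => ?_⟩
  by_contra! h
  have : lowSpan T x = ⊥ := lowSpan_eq_bot hT fun i => h.trans_le (hc ⟨i, rfl⟩)
  change k < Module.finrank ℂ (lowSpan T x) at hx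
  rw [this, finrank_bot] at hx
  exact Nat.not_lt_zero k hx

theorem exists_lowSpan_eq_top (hT : T.IsSymmetric) : ∃ x, lowSpan T x = ⊤ := by
  obtain ⟨c, hc⟩ := (Set.finite_range (hT.eigenvalues rfl)).bddAbove
  refine ⟨c, ?_⟩
  rw [eq_top_iff, ← (hT.eigenvectorBasis rfl).toBasis.span_eq, Submodule.span_le]
  rintro _ ⟨i, rfl⟩
  simpa using eigenvectorBasis_mem_lowSpan hT (hc ⟨i, rfl⟩)

theorem exists_eigenvalue_eq_spectralLevel_zero [Nontrivial E] (hT : T.IsSymmetric) :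
    ∃ i₀, hT.eigenvalues rfl i₀ = spectralLevel T 0 ∧
      ∀ i, spectralLevel T 0 ≤ hT.eigenvalues rfl i := by
  have : Nonempty (Fin (Module.finrank ℂ E)) := ⟨⟨0, Module.finrank_pos⟩⟩
  obtain ⟨i₀, h₀⟩ := Finite.exists_min (hT.eigenvalues rfl)
  have key : spectralLevel T 0 = hT.eigenvalues rfl i₀ := by
    have : {x : ℝ | 0 < Module.finrank ℂ (lowSpan T x)} = Set.Ici (hT.eigenvalues rfl i₀) := by
      ext x
      change 0 < Module.finrank ℂ (lowSpan T x) ↔ hT.eigenvalues rfl i₀ ≤ x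
      constructor
      · intro hx
        by_contra! h
        have : lowSpan T x = ⊥ := lowSpan_eq_bot hT fun i => h.trans_le (h₀ i)
        rw [this, finrank_bot] at hx
        exact lt_irrefl 0 hx
      · intro hx
        rw [Module.finrank_pos_iff, Submodule.nontrivial_iff_ne_bot]
        intro hbot
        have := eigenvectorBasis_mem_lowSpan hT hx
        rw [hbot, Submodule.mem_bot] at this
        exact (hT.eigenvectorBasis rfl).orthonormal.ne_zero i₀ this
    rw [spectralLevel, this, csInf_Ici]
  exact ⟨i₀, key.symm, fun i => key ▸ h₀ i⟩

theorem spectralLevel_zero_le_inner [Nontrivial E] (hT : T.IsSymmetric) (v : E) :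
    spectralLevel T 0 * ‖v‖ ^ 2 ≤ (inner ℂ v (T v)).re := by
  obtain ⟨i₀, -, h⟩ := exists_eigenvalue_eq_spectralLevel_zero hT
  rw [inner_apply_eq_sum hT, norm_sq_eq_sum_repr (hT.eigenvectorBasis rfl), Finset.mul_sum]
  refine Finset.sum_le_sum fun i _ => ?_
  gcongr
  exact h i

/-- In an eigenbasis the excess energy is a sum of nonnegative terms. If it vanishes, every
coefficient off the lowest eigenvalue vanishes. -/
theorem apply_eq_of_inner_le [Nontrivial E] (hT : T.IsSymmetric) {v : E}
    (hv : (inner ℂ v (T v)).re ≤ spectralLevel T 0 * ‖v‖ ^ 2) :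
    T v = (spectralLevel T 0 : ℂ) • v := by
  obtain ⟨i₀, -, h⟩ := exists_eigenvalue_eq_spectralLevel_zero hT
  rw [inner_apply_eq_sum hT, norm_sq_eq_sum_repr (hT.eigenvectorBasis rfl), Finset.mul_sum,
    ← sub_nonpos, ← Finset.sum_sub_distrib] at hv
  have hnn : ∀ i ∈ Finset.univ, 0 ≤ hT.eigenvalues rfl i * ‖(hT.eigenvectorBasis rfl).repr v i‖ ^ 2
      - spectralLevel T 0 * ‖(hT.eigenvectorBasis rfl).repr v i‖ ^ 2 := fun i _ => by
    rw [← sub_mul]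
    exact mul_nonneg (sub_nonneg.mpr (h i)) (sq_nonneg _)
  have h0 := (Finset.sum_eq_zero_iff_of_nonneg hnn).mp (le_antisymm hv (Finset.sum_nonneg hnn))
  apply (hT.eigenvectorBasis rfl).repr.injective
  ext i
  rw [hT.eigenvectorBasis_apply_self_apply, map_smul, PiLp.smul_apply, smul_eq_mul]
  have := h0 i (Finset.mem_univ i)
  rw [← sub_mul] at this
  rcases mul_eq_zero.mp this with h1 | h1
  · rw [sub_eq_zero.mp h1]; rfl
  · rw [pow_eq_zero_iff two_ne_zero, norm_eq_zero] at h1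
    simp [h1]

theorem exists_ground_vector [Nontrivial E] (hT : T.IsSymmetric) :
    ∃ v : E, ‖v‖ = 1 ∧ T v = (spectralLevel T 0 : ℂ) • v := by
  obtain ⟨i₀, h0, -⟩ := exists_eigenvalue_eq_spectralLevel_zero hT
  refine ⟨hT.eigenvectorBasis rfl i₀, (hT.eigenvectorBasis rfl).orthonormal.1 i₀, ?_⟩
  rw [hT.apply_eigenvectorBasis, h0]; rfl

/-- A version of the min-max principle for the second eigenvalue. -/
theorem spectralLevel_one_le [Nontrivial E] (hT : T.IsSymmetric) {W : Submodule ℂ E}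
    (hW : 1 < Module.finrank ℂ W) {x : ℝ}
    (hx : ∀ v ∈ W, (inner ℂ v (T v)).re ≤ x * ‖v‖ ^ 2) : spectralLevel T 1 ≤ x := by
  obtain ⟨i₀, h0, hmin⟩ := exists_eigenvalue_eq_spectralLevel_zero hT
  -- As `W` has dimension at least two, it contains a nonzero vector orthogonal to a chosen lowest
  -- eigenvector; only the remaining eigenvalues, all at least the second level, enter its energy.
  have hker : LinearMap.ker
      ((innerSL ℂ (hT.eigenvectorBasis rfl i₀) : E →ₗ[ℂ] ℂ) ∘ₗ W.subtype) ≠ ⊥ := by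
    apply LinearMap.ker_ne_bot_of_finrank_lt
    simpa using hW
  obtain ⟨⟨v, hvW⟩, hv, hv0⟩ := Submodule.exists_mem_ne_zero_of_ne_bot hker
  have hv0' : v ≠ 0 := fun h => hv0 (Subtype.ext h)
  have hvi : (hT.eigenvectorBasis rfl).repr v i₀ = 0 := by
    rw [OrthonormalBasis.repr_apply_apply]
    simpa using hv
  have hlev : ∀ i, i ≠ i₀ → spectralLevel T 1 ≤ hT.eigenvalues rfl i := by
    intro i hi
    refine csInf_le (bddBelow_levelSet hT 1) ?_
    have hli : LinearIndependent ℂ ![hT.eigenvectorBasis rfl i, hT.eigenvectorBasis rfl i₀] := by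
      have := (hT.eigenvectorBasis rfl).orthonormal.linearIndependent.comp ![i, i₀] (by
        intro p q hpq
        fin_cases p <;> fin_cases q <;> simp_all)
      have h3 : hT.eigenvectorBasis rfl ∘ ![i, i₀] =
          ![hT.eigenvectorBasis rfl i, hT.eigenvectorBasis rfl i₀] := by
        funext p
        fin_cases p <;> rfl
      rwa [h3] at this
    have hspan : Submodule.span ℂ
        (Set.range ![hT.eigenvectorBasis rfl i, hT.eigenvectorBasis rfl i₀])
        ≤ lowSpan T (hT.eigenvalues rfl i) := by
      rw [Submodule.span_le]
      rintro _ ⟨p, rfl⟩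
      fin_cases p
      · exact eigenvectorBasis_mem_lowSpan hT le_rfl
      · exact eigenvectorBasis_mem_lowSpan hT (h0 ▸ hmin i)
    have h2 := Submodule.finrank_mono hspan
    rw [finrank_span_eq_card hli] at h2
    rw [Fintype.card_fin] at h2
    exact h2
  have hlow : spectralLevel T 1 * ‖v‖ ^ 2 ≤ (inner ℂ v (T v)).re := by
    rw [inner_apply_eq_sum hT, norm_sq_eq_sum_repr (hT.eigenvectorBasis rfl), Finset.mul_sum]
    refine Finset.sum_le_sum fun i _ => ?_
    by_cases hi : i = i₀
    · simp [hi, hvi]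
    · gcongr
      exact hlev i hi
  have hpos : 0 < ‖v‖ ^ 2 := by positivity
  exact le_of_mul_le_mul_right (hlow.trans (hx v hvW)) hpos

theorem finrank_eigenspace_eq_one [Nontrivial E] (hT : T.IsSymmetric)
    (h : spectralLevel T 0 < spectralLevel T 1) :
    Module.finrank ℂ (Module.End.eigenspace T (spectralLevel T 0 : ℂ)) = 1 := by
  refine le_antisymm ?_ ?_
  · by_contra! h1
    have : spectralLevel T 1 ≤ spectralLevel T 0 :=
      csInf_le (bddBelow_levelSet hT 1)
        (h1.trans_le (Submodule.finrank_mono (eigenspace_le_lowSpan T le_rfl)))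
    linarith
  · obtain ⟨v, hv1, hv⟩ := exists_ground_vector hT
    rw [Nat.succ_le_iff, Module.finrank_pos_iff, Submodule.nontrivial_iff_ne_bot,
      Submodule.ne_bot_iff]
    exact ⟨v, Module.End.mem_eigenspace_iff.mpr hv, by rintro rfl; simp at hv1⟩

/-- If `T` dominates `T₀ + c` and the ground state of `T₀` has energy at most `E₀ + c + d` for `T`,
then the gap of `T` is at least that of `T₀` minus `d`. -/
theorem gap_sub_le_gap {T₀ : E →ₗ[ℂ] E} (hT₀ : T₀.IsSymmetric) (hT : T.IsSymmetric)
    (hE : 1 < Module.finrank ℂ E) {c d : ℝ} {ψ : E} (hψ : ‖ψ‖ = 1)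
    (hle : ∀ v, (inner ℂ v (T₀ v)).re + c * ‖v‖ ^ 2 ≤ (inner ℂ v (T v)).re)
    (hψT : (inner ℂ ψ (T ψ)).re ≤ spectralLevel T₀ 0 + c + d) :
    spectralLevel T₀ 1 - spectralLevel T₀ 0 - d ≤ spectralLevel T 1 - spectralLevel T 0 := by
  have : Nontrivial E := Module.nontrivial_of_finrank_pos (by omega : 0 < Module.finrank ℂ E)
  have h0 : spectralLevel T 0 ≤ spectralLevel T₀ 0 + c + d := by
    simpa [hψ] using (spectralLevel_zero_le_inner hT ψ).trans (by simpa [hψ] using hψT)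
  -- A low-energy space of `T` of dimension at least two is a trial space for `T₀`, with energies
  -- lower by at least `c`.
  have h1 : spectralLevel T₀ 1 + c ≤ spectralLevel T 1 := by
    refine le_csInf ?_ fun x hx => ?_
    · obtain ⟨x, hx⟩ := exists_lowSpan_eq_top hT
      refine ⟨x, ?_⟩
      change 1 < Module.finrank ℂ (lowSpan T x)
      rw [hx, finrank_top]
      exact hE
    · rw [← le_sub_iff_add_le]
      refine spectralLevel_one_le hT₀ hx fun v hv => ?_
      have := inner_le_of_mem_lowSpan hT hv
      linarith [hle v]
  linarith

end Spectral

/-! ### Singular value decomposition of real square matrices -/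

section SingularValues

variable {E : Type*} [NormedAddCommGroup E] [InnerProductSpace ℝ E] [FiniteDimensional ℝ E]

/-- An eigenbasis `u` of `T* T` has pairwise orthogonal images under `T`. The nonzero ones are
normalised and completed to an orthonormal basis `v`; the others get `s k = 0`. -/
theorem exists_orthonormalBasis_map_eq_smul {n : ℕ} (hn : Module.finrank ℝ E = n) (T : E →ₗ[ℝ] E) :
    ∃ (u v : OrthonormalBasis (Fin n) ℝ E) (s : Fin n → ℝ), ∀ k, T (u k) = s k • v k := by
  have hS : (LinearMap.adjoint T ∘ₗ T).IsSymmetric := T.isSymmetric_adjoint_mul_self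
  set u := hS.eigenvectorBasis hn with hu
  set l := hS.eigenvalues hn with hl
  have hinner : ∀ i j, inner ℝ (T (u i)) (T (u j)) = l j * (if i = j then 1 else 0) := by
    intro i j
    rw [← LinearMap.adjoint_inner_right, ← LinearMap.comp_apply, hu,
      hS.apply_eigenvectorBasis, inner_smul_right,
      orthonormal_iff_ite.mp (hS.eigenvectorBasis hn).orthonormal]
    rfl
  have hnorm : ∀ i, ‖T (u i)‖ ^ 2 = l i := by
    intro i
    rw [← real_inner_self_eq_norm_sq, hinner]
    simp
  have hnz : ∀ i, l i ≠ 0 → ‖T (u i)‖ ≠ 0 := by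
    intro i hi h
    rw [← hnorm, h] at hi
    simp at hi
  have horth : Orthonormal ℝ
      (fun i : {i | l i ≠ 0} => (‖T (u i)‖)⁻¹ • T (u i)) := by
    rw [orthonormal_iff_ite]
    rintro ⟨i, hi⟩ ⟨j, hj⟩
    simp only [inner_smul_left, inner_smul_right, hinner, Subtype.mk.injEq]
    by_cases hij : i = j
    · subst hij
      simp only [if_true, ← hnorm]
      have := hnz i hi
      simp only [RCLike.conj_to_real]
      field_simp
    · simp [hij]
  obtain ⟨v, hv⟩ := Orthonormal.exists_orthonormalBasis_extension_of_card_eq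
    (v := fun i => (‖T (u i)‖)⁻¹ • T (u i)) (s := {i | l i ≠ 0}) (by simpa using hn) horth
  refine ⟨u, v, fun i => ‖T (u i)‖, fun k => ?_⟩
  by_cases hk : l k = 0
  · dsimp only
    have : ‖T (u k)‖ = 0 := by simpa [hk] using hnorm k
    rw [this, norm_eq_zero.mp this, zero_smul]
  · dsimp only
    rw [hv k hk, smul_smul, mul_inv_cancel₀ (hnz k hk), one_smul]

/-- The singular value decomposition of a real square matrix. -/
theorem exists_singular_value_decomposition {n : ℕ} (B : Matrix (Fin n) (Fin n) ℝ) :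
    ∃ (U V : Matrix (Fin n) (Fin n) ℝ) (s : Fin n → ℝ),
      U * U.transpose = 1 ∧ V * V.transpose = 1 ∧ B = U.transpose * Matrix.diagonal s * V := by
  -- The transpose is used because the basis vectors become rows: `Bᵀ u_k = s_k v_k` reads `U B =
  -- diag(s) V`.
  obtain ⟨u, v, s, h⟩ := exists_orthonormalBasis_map_eq_smul (E := EuclideanSpace ℝ (Fin n))
    (n := n) (by simp) (Matrix.toEuclideanLin B.transpose)
  have horth : ∀ w : OrthonormalBasis (Fin n) ℝ (EuclideanSpace ℝ (Fin n)),
      (Matrix.of fun k i => w k i) * (Matrix.of fun k i => w k i).transpose = 1 := by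
    intro w
    ext k l
    have := orthonormal_iff_ite.mp w.orthonormal l k
    rw [PiLp.inner_apply] at this
    simp only [Matrix.mul_apply, Matrix.transpose_apply, Matrix.of_apply, Matrix.one_apply]
    simpa [eq_comm] using this
  refine ⟨Matrix.of fun k i => u k i, Matrix.of fun k i => v k i, s, horth u, horth v, ?_⟩
  have h2 : (Matrix.of fun k i => u k i) * B = Matrix.diagonal s * Matrix.of fun k i => v k i := by
    ext k j
    have := congrArg (fun x : EuclideanSpace ℝ (Fin n) => x j) (h k)
    rw [Matrix.diagonal_mul, Matrix.mul_apply]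
    simpa [ Matrix.mulVec, dotProduct, mul_comm] using this
  rw [Matrix.mul_assoc, ← h2, ← Matrix.mul_assoc, mul_eq_one_comm.mp (horth u), Matrix.one_mul]

end SingularValues

/-! ### Majorana operators, mode changes and Wick-type estimates -/

section Majorana

variable {E : Type*} [NormedAddCommGroup E] [InnerProductSpace ℂ E]
  {ι : Type*}

/-- Majorana operators: `a i` are self-adjoint with square `1`, `b i` are skew-adjoint with square
`-1`, and all of them anticommute. -/
structure IsMajorana [DecidableEq ι] (a b : ι → Module.End ℂ E) : Prop where
  aa : ∀ i j, a i * a j + a j * a i = if i = j then algebraMap ℂ _ 2 else 0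
  bb : ∀ i j, b i * b j + b j * b i = if i = j then algebraMap ℂ _ (-2) else 0
  ab : ∀ i j, a i * b j + b j * a i = 0
  a_symm : ∀ i x y, inner ℂ (a i x) y = inner ℂ x (a i y)
  b_skew : ∀ i x y, inner ℂ (b i x) y = -inner ℂ x (b i y)

namespace IsMajorana

variable [DecidableEq ι] {a b : ι → Module.End ℂ E} (h : IsMajorana a b)
include h

theorem mul_self_eq_one (i : ι) : a i * a i = 1 := by
  have := h.aa i i
  rw [if_pos rfl, ← two_smul ℂ, Algebra.algebraMap_eq_smul_one] at this
  exact smul_right_injective _ two_ne_zero this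

theorem mul_self_eq_neg_one (i : ι) : b i * b i = -1 := by
  have := h.bb i i
  rw [if_pos rfl, ← two_smul ℂ, Algebra.algebraMap_eq_smul_one, neg_smul, ← smul_neg] at this
  exact smul_right_injective _ two_ne_zero this

theorem apply_apply_self (i : ι) (x : E) : a i (a i x) = x := by
  rw [← Module.End.mul_apply, h.mul_self_eq_one, Module.End.one_apply]

theorem apply_apply_comm {i j : ι} (hij : i ≠ j) (x : E) : a i (a j x) = -a j (a i x) := by
  have := LinearMap.congr_fun (h.aa i j) x
  rw [if_neg hij] at this
  exact eq_neg_of_add_eq_zero_left this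

theorem skew_apply_apply (i j : ι) (x : E) : b j (a i x) = -a i (b j x) :=
  eq_neg_of_add_eq_zero_right (LinearMap.congr_fun (h.ab i j) x)

/-- The sign from anticommuting cancels against `b i * b i = -1`. Consequently the only possible
eigenvalues of a mode are `±1`. -/
theorem pair_sq (i : ι) : a i * b i * (a i * b i) = 1 := by
  have h1 : b i * a i = -(a i * b i) := eq_neg_of_add_eq_zero_right (h.ab i i)
  rw [mul_assoc, ← mul_assoc (b i), h1, neg_mul, mul_neg, mul_assoc, h.mul_self_eq_neg_one,
    ← mul_assoc, h.mul_self_eq_one, one_mul, neg_neg]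

theorem commute_pair (i j : ι) : Commute (a i * b i) (a j * b j) := by
  rcases eq_or_ne i j with rfl | hij
  · exact Commute.refl _
  ext x
  have hb : ∀ y, b i (b j y) = -b j (b i y) := fun y => by
    have := LinearMap.congr_fun (h.bb i j) y
    rw [if_neg hij] at this
    exact eq_neg_of_add_eq_zero_left this
  simp only [Module.End.mul_apply, h.skew_apply_apply, map_neg, hb, neg_neg]
  rw [h.apply_apply_comm hij]

variable {ψ : E} {σ : ι → ℝ}

/-- The vectors `a k (a l ψ)` and `a m (a n ψ)` are orthogonal unless the index `l` is repeated. -/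
theorem inner_pair_eq_zero (hσ : ∀ k, σ k * σ k = 1) (hψ : ∀ k, b k ψ = (σ k : ℂ) • a k ψ)
    {k l m n : ι} (hk : l ≠ k) (hm : l ≠ m) (hn : l ≠ n) :
    inner ℂ (a k (a l ψ)) (a m (a n ψ)) = 0 := by
  have hσ' : (σ l : ℂ) * σ l = 1 := by exact_mod_cast hσ l
  have hal : a l ψ = (σ l : ℂ) • b l ψ := by rw [hψ, smul_smul, hσ', one_smul]
  -- The mode `l` is moved to the right-hand vector in two ways: as `b l`, using `a l ψ = σ l • b l
  -- ψ`, and directly as `a l`. The results differ by a sign, so the inner product is zero.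
  have h1 : inner ℂ (a k (a l ψ)) (a m (a n ψ)) = inner ℂ (a k ψ) (a m (a n (a l ψ))) := by
    conv_lhs => rw [hal, map_smul, ← neg_neg (a k (b l ψ)), ← h.skew_apply_apply]
    rw [inner_smul_left, inner_neg_left, h.b_skew, neg_neg, h.skew_apply_apply,
      h.skew_apply_apply, map_neg, neg_neg, hψ, map_smul, map_smul, inner_smul_right,
      Complex.conj_ofReal, ← mul_assoc, hσ', one_mul]
  have h2 : inner ℂ (a k (a l ψ)) (a m (a n ψ)) = -inner ℂ (a k ψ) (a m (a n (a l ψ))) := by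
    rw [h.apply_apply_comm hk.symm, inner_neg_left, h.a_symm, h.apply_apply_comm hm,
      h.apply_apply_comm hn, map_neg, neg_neg]
  linear_combination (h1 + h2) / 2

theorem inner_pair_self (hψ1 : ‖ψ‖ = 1) (k l : ι) :
    inner ℂ (a k (a l ψ)) (a k (a l ψ)) = 1 := by
  rw [h.a_symm, h.apply_apply_self, h.a_symm, h.apply_apply_self, inner_self_eq_norm_sq_to_K, hψ1]
  simp

theorem inner_pair (hσ : ∀ k, σ k * σ k = 1) (hψ : ∀ k, b k ψ = (σ k : ℂ) • a k ψ)
    (hψ1 : ‖ψ‖ = 1) {p q : ι × ι} (hp : p.1 ≠ p.2) (hq : q.1 ≠ q.2) :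
    inner ℂ (a p.1 (a p.2 ψ)) (a q.1 (a q.2 ψ)) =
      (if q = p then 1 else 0) - (if q = p.swap then 1 else 0) := by
  obtain ⟨k, l⟩ := p
  obtain ⟨m, n⟩ := q
  simp only [Prod.swap_prod_mk, Prod.mk.injEq] at *
  by_cases h1 : m = k ∧ n = l
  · obtain ⟨rfl, rfl⟩ := h1
    rw [h.inner_pair_self hψ1, if_pos ⟨rfl, rfl⟩, if_neg (fun h => hq h.1), sub_zero]
  by_cases h2 : m = l ∧ n = k
  · obtain ⟨rfl, rfl⟩ := h2
    rw [h.apply_apply_comm hp, inner_neg_left, h.inner_pair_self hψ1, if_neg h1,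
      if_pos ⟨rfl, rfl⟩, zero_sub]
  rw [if_neg h1, if_neg h2, sub_zero]
  by_cases h3 : l = m ∨ l = n
  · rw [h.apply_apply_comm hp, inner_neg_left,
      h.inner_pair_eq_zero hσ hψ hp (by grind) (by grind), neg_zero]
  · push Not at h3
    exact h.inner_pair_eq_zero hσ hψ hp.symm h3.1 h3.2

end IsMajorana

variable [Fintype ι]

/-- Linear combinations of operators. -/
def combine (U : Matrix ι ι ℝ) (a : ι → Module.End ℂ E) (k : ι) : Module.End ℂ E :=
  ∑ i, (U k i : ℂ) • a i

/-- The bilinear expression `∑ X i j a_i b_j`. -/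
def bilinear (X : Matrix ι ι ℝ) (a b : ι → Module.End ℂ E) : Module.End ℂ E :=
  ∑ i, ∑ j, (X i j : ℂ) • (a i * b j)

theorem bilinear_combine (X U V : Matrix ι ι ℝ) (a b : ι → Module.End ℂ E) :
    bilinear X (combine U a) (combine V b) = bilinear (U.transpose * X * V) a b := by
  have h1 : ∀ k l, (X k l : ℂ) • (combine U a k * combine V b l) =
      ∑ i, ∑ j, ((U k i * X k l * V l j : ℝ) : ℂ) • (a i * b j) := by
    intro k l
    simp only [combine, Finset.sum_mul, Finset.mul_sum, Finset.smul_sum, smul_mul_smul_comm,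
      smul_smul]
    rw [Finset.sum_comm]
    refine Finset.sum_congr rfl fun i _ => Finset.sum_congr rfl fun j _ => ?_
    congr 1
    push_cast
    ring
  simp only [bilinear, h1, Matrix.mul_apply, Matrix.transpose_apply, Finset.sum_mul,
    Complex.ofReal_sum, Finset.sum_smul]
  calc _ = ∑ k, ∑ i, ∑ l, ∑ j, ((U k i * X k l * V l j : ℝ) : ℂ) • (a i * b j) :=
        Finset.sum_congr rfl fun k _ => Finset.sum_comm
    _ = ∑ i, ∑ k, ∑ l, ∑ j, ((U k i * X k l * V l j : ℝ) : ℂ) • (a i * b j) := Finset.sum_comm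
    _ = _ := by
        refine Finset.sum_congr rfl fun i _ => ?_
        calc _ = ∑ k, ∑ j, ∑ l, ((U k i * X k l * V l j : ℝ) : ℂ) • (a i * b j) :=
              Finset.sum_congr rfl fun k _ => Finset.sum_comm
          _ = ∑ j, ∑ k, ∑ l, ((U k i * X k l * V l j : ℝ) : ℂ) • (a i * b j) := Finset.sum_comm
          _ = _ := Finset.sum_congr rfl fun j _ => Finset.sum_comm

variable [DecidableEq ι]

/-- One bilinear computation serves all three anticommutation relations, with `c` equal to `2`, `-2`
and `0`. -/
theorem combine_mul_combine_add {a b : ι → Module.End ℂ E} (U V : Matrix ι ι ℝ) (c : ℂ)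
    (h : ∀ i j, a i * b j + b j * a i = if i = j then algebraMap ℂ _ c else 0) (k l : ι) :
    combine U a k * combine V b l + combine V b l * combine U a k =
      algebraMap ℂ _ (((U * V.transpose) k l : ℝ) * c) := by
  have h1 : combine U a k * combine V b l + combine V b l * combine U a k =
      ∑ i, ∑ j, ((U k i * V l j : ℝ) : ℂ) • (a i * b j + b j * a i) := by
    simp only [combine, Finset.sum_mul, Finset.mul_sum, smul_mul_smul_comm, smul_add,
      Finset.sum_add_distrib]
    congr 1
    · rw [Finset.sum_comm]
      simp
    · refine Finset.sum_congr rfl fun i _ => Finset.sum_congr rfl fun j _ => ?_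
      rw [mul_comm]; simp
  rw [h1]
  simp only [h, smul_ite, smul_zero, Finset.sum_ite_eq, Finset.mem_univ, if_true,
    Matrix.mul_apply, Matrix.transpose_apply, Complex.ofReal_sum, Finset.sum_mul, map_sum]
  refine Finset.sum_congr rfl fun i _ => ?_
  rw [Algebra.algebraMap_eq_smul_one, Algebra.algebraMap_eq_smul_one, smul_smul]

theorem IsMajorana.combine {a b : ι → Module.End ℂ E} (h : IsMajorana a b) {U V : Matrix ι ι ℝ}
    (hU : U * U.transpose = 1) (hV : V * V.transpose = 1) :
    IsMajorana (combine U a) (combine V b) where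
  aa k l := by
    rw [combine_mul_combine_add U U 2 h.aa, hU, Matrix.one_apply]
    split_ifs <;> simp
  bb k l := by
    rw [combine_mul_combine_add V V (-2) h.bb, hV, Matrix.one_apply]
    split_ifs <;> simp
  ab k l := by
    rw [combine_mul_combine_add U V 0 (by simpa using h.ab)]
    simp
  a_symm k x y := by
    simp [NumberConservingWire.combine, h.a_symm]
  b_skew k x y := by
    simp [NumberConservingWire.combine, h.b_skew]

namespace IsMajorana

variable {a b : ι → Module.End ℂ E} (h : IsMajorana a b)
include h

section Wick

variable {ψ : E} {σ : ι → ℝ}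

/-- By `inner_pair` the squared norm equals `∑ R p (R p - R p.swap)`; the factor `2` accounts for
each pair of modes occurring in both orders. -/
theorem norm_sum_pair_sq_le (hσ : ∀ k, σ k * σ k = 1) (hψ : ∀ k, b k ψ = (σ k : ℂ) • a k ψ)
    (hψ1 : ‖ψ‖ = 1) (R : ι × ι → ℝ) :
    ‖∑ p ∈ Finset.univ.offDiag, (R p : ℂ) • a p.1 (a p.2 ψ)‖ ^ 2 ≤ 2 * ∑ p, R p ^ 2 := by
  have hswap : ∑ p ∈ (Finset.univ : Finset ι).offDiag, R p.swap ^ 2 =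
      ∑ p ∈ (Finset.univ : Finset ι).offDiag, R p ^ 2 :=
    Finset.sum_equiv (Equiv.prodComm ι ι) (by simp [ne_comm]) (by simp)
  have hC : ((‖∑ p ∈ Finset.univ.offDiag, (R p : ℂ) • a p.1 (a p.2 ψ)‖ ^ 2 : ℝ) : ℂ) =
      ((∑ p ∈ Finset.univ.offDiag, R p * (R p - R p.swap) : ℝ) : ℂ) := by
    push_cast
    have := inner_self_eq_norm_sq_to_K (𝕜 := ℂ)
      (∑ p ∈ Finset.univ.offDiag, (R p : ℂ) • a p.1 (a p.2 ψ))
    refine this.symm.trans ?_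
    rw [sum_inner]
    refine Finset.sum_congr rfl fun p hp => ?_
    rw [inner_smul_left, Complex.conj_ofReal, inner_sum]
    congr 1
    have hp' : p.1 ≠ p.2 := by simpa using hp
    have hps : p.swap ∈ (Finset.univ : Finset ι).offDiag := by simpa using hp'.symm
    calc _ = ∑ q ∈ (Finset.univ : Finset ι).offDiag,
          ((if q = p then (R q : ℂ) else 0) - (if q = p.swap then (R q : ℂ) else 0)) := by
          refine Finset.sum_congr rfl fun q hq => ?_
          rw [inner_smul_right, h.inner_pair hσ hψ hψ1 hp' (by simpa using hq), mul_sub]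
          simp
      _ = _ := by
          rw [Finset.sum_sub_distrib, Finset.sum_ite_eq', Finset.sum_ite_eq', if_pos hp,
            if_pos hps]
  have hR := Complex.ofReal_injective hC
  rw [hR]
  -- The termwise difference of the two sides is `(R p + R p.swap)² / 2`.
  calc _ ≤ ∑ p ∈ (Finset.univ : Finset ι).offDiag, (3 / 2 * R p ^ 2 + 1 / 2 * R p.swap ^ 2) :=
        Finset.sum_le_sum fun p _ => by nlinarith [sq_nonneg (R p + R p.swap)]
    _ = 2 * ∑ p ∈ (Finset.univ : Finset ι).offDiag, R p ^ 2 := by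
        rw [Finset.sum_add_distrib, ← Finset.mul_sum, ← Finset.mul_sum, hswap]; ring
    _ ≤ _ := by
        gcongr
        exact Finset.subset_univ _

/-- On `ψ` each `b` becomes `±a`. The diagonal terms then give a multiple of `ψ`, which is the
constant `c`; the off-diagonal ones are controlled by the squared entries of `O`, whose rows have
norm one. -/
theorem norm_bilinear_sub_sq_le (hσ : ∀ k, σ k * σ k = 1)
    (hψ : ∀ k, b k ψ = (σ k : ℂ) • a k ψ) (hψ1 : ‖ψ‖ = 1) {O : Matrix ι ι ℝ}
    (hO : O * O.transpose = 1) :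
    ∃ c : ℝ, ‖bilinear O a b ψ - (c : ℂ) • ψ‖ ^ 2 ≤ 2 * Fintype.card ι := by
  have hsum : ∑ p : ι × ι, (O p.1 p.2 * σ p.2) ^ 2 = Fintype.card ι := by
    have h1 : ∀ k, ∑ l, (O k l * σ l) ^ 2 = 1 := fun k => by
      have h2 := congrFun (congrFun hO k) k
      rw [Matrix.mul_apply, Matrix.one_apply_eq] at h2
      rw [← h2]
      refine Finset.sum_congr rfl fun l _ => ?_
      rw [Matrix.transpose_apply]
      linear_combination O k l ^ 2 * hσ l
    rw [Fintype.sum_prod_type]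
    simp [h1]
  refine ⟨∑ k, O k k * σ k, ?_⟩
  have hb : bilinear O a b ψ = ∑ p : ι × ι, ((O p.1 p.2 * σ p.2 : ℝ) : ℂ) • a p.1 (a p.2 ψ) := by
    rw [Fintype.sum_prod_type]
    simp only [bilinear, LinearMap.sum_apply, LinearMap.smul_apply, Module.End.mul_apply, hψ,
      map_smul, smul_smul, Complex.ofReal_mul]
  have hsplit : bilinear O a b ψ - ((∑ k, O k k * σ k : ℝ) : ℂ) • ψ =
      ∑ p ∈ Finset.univ.offDiag, ((O p.1 p.2 * σ p.2 : ℝ) : ℂ) • a p.1 (a p.2 ψ) := by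
    rw [hb, sub_eq_iff_eq_add', ← Finset.univ_product_univ, ← Finset.diag_union_offDiag,
      Finset.sum_union (Finset.disjoint_diag_offDiag _), Finset.sum_diag]
    simp [h.apply_apply_self, Finset.sum_smul]
  rw [hsplit, ← hsum]
  exact h.norm_sum_pair_sq_le hσ hψ hψ1 fun p => O p.1 p.2 * σ p.2

/-- If `ψ` is an eigenvector of the bilinears `α k * β k` of some modes `α`, `β`, then
`∑ i, a i * b i` has fluctuations of size at most `√(2 L)` in the state `ψ`. -/
theorem norm_bilinear_one_sub_sq_le {U V : Matrix ι ι ℝ} (hU : U * U.transpose = 1)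
    (hV : V * V.transpose = 1) (hψ1 : ‖ψ‖ = 1)
    (hψ : ∀ k, ∃ c : ℂ, (NumberConservingWire.combine U a k *
      NumberConservingWire.combine V b k) ψ = c • ψ) :
    ∃ c : ℝ, ‖bilinear 1 a b ψ - (c : ℂ) • ψ‖ ^ 2 ≤ 2 * Fintype.card ι := by
  have hm := h.combine hU hV
  have hψ0 : ψ ≠ 0 := by rintro rfl; simp at hψ1
  -- The eigenvalue of a mode squares to one by `pair_sq`, so it is a real sign.
  have key : ∀ k, ∃ s : ℝ, s * s = 1 ∧ NumberConservingWire.combine V b k ψ =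
      (s : ℂ) • NumberConservingWire.combine U a k ψ := by
    intro k
    obtain ⟨c, hc⟩ := hψ k
    have h1 := LinearMap.congr_fun (hm.pair_sq k) ψ
    rw [Module.End.mul_apply, hc, map_smul, hc, smul_smul, Module.End.one_apply] at h1
    have h2 : c * c = 1 := smul_left_injective ℂ hψ0 (by simpa using h1)
    have h3 : NumberConservingWire.combine V b k ψ = c • NumberConservingWire.combine U a k ψ := by
      rw [← map_smul, ← hc, Module.End.mul_apply, hm.apply_apply_self]
    rcases mul_self_eq_one_iff.mp h2 with rfl | rfl
    · exact ⟨1, by norm_num, by simpa using h3⟩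
    · exact ⟨-1, by norm_num, by simpa using h3⟩
  choose σ hσ hψσ using key
  -- In the modes, `∑ a_i b_i` has the matrix `U Vᵀ`, since `Uᵀ (U Vᵀ) V = 1`, and this matrix is
  -- orthogonal.
  have hO : (U * V.transpose) * (U * V.transpose).transpose = 1 := by
    rw [Matrix.transpose_mul, Matrix.transpose_transpose, Matrix.mul_assoc,
      ← Matrix.mul_assoc V.transpose, mul_eq_one_comm.mp hV, Matrix.one_mul, hU]
  have h1 : bilinear 1 a b = bilinear (U * V.transpose) (NumberConservingWire.combine U a)
      (NumberConservingWire.combine V b) := by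
    rw [bilinear_combine, ← Matrix.mul_assoc, mul_eq_one_comm.mp hU, Matrix.one_mul,
      mul_eq_one_comm.mp hV]
  rw [h1]
  exact hm.norm_bilinear_sub_sq_le hσ hψσ hψ1 hO

end Wick

end IsMajorana

end Majorana

/-! ### The Fock space, Jordan–Wigner signs and the Kitaev chain -/

section Fock

open scoped symmDiff

variable {L : ℕ}

/-- The fermionic Fock space of the wire. -/
abbrev Fock (L : ℕ) : Type := EuclideanSpace ℂ (Finset (Fin L))

/-- The operator that flips the occupations of the sites in `A`, with weights `s`. -/
def flipOp (A : Finset (Fin L)) (s : Finset (Fin L) → ℝ) : Module.End ℂ (Fock L) where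
  toFun v := WithLp.toLp 2 fun S => (s S : ℂ) * v (S ∆ A)
  map_add' v w := by ext S; simp [mul_add]
  map_smul' c v := by ext S; simp [mul_left_comm]

theorem flipOp_apply (A : Finset (Fin L)) (s : Finset (Fin L) → ℝ) (v : Fock L)
    (S : Finset (Fin L)) : flipOp A s v S = (s S : ℂ) * v (S ∆ A) := rfl

theorem inner_flipOp (A : Finset (Fin L)) (s : Finset (Fin L) → ℝ) (v w : Fock L) :
    inner ℂ (flipOp A s v) w = inner ℂ v (flipOp A (fun S => s (S ∆ A)) w) := by
  simp only [PiLp.inner_apply, flipOp_apply, RCLike.inner_apply]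
  have hinv : Function.Involutive (fun S : Finset (Fin L) => S ∆ A) := fun S =>
    symmDiff_symmDiff_cancel_right A S
  rw [← Equiv.sum_comp hinv.toPerm]
  refine Finset.sum_congr rfl fun S _ => ?_
  simp only [Function.Involutive.coe_toPerm, symmDiff_symmDiff_cancel_right, map_mul,
    Complex.conj_ofReal]
  ring

/-- The fermionic sign as a real number. -/
def jwSign (j : Fin L) (S : Finset (Fin L)) : ℝ := (-1) ^ (S.filter (fun k => k < j)).card

/-- `-1` if the site `j` is occupied, `1` otherwise. -/
def occSign (j : Fin L) (S : Finset (Fin L)) : ℝ := if j ∈ S then -1 else 1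

theorem jwSign_mul_self (j : Fin L) (S : Finset (Fin L)) : jwSign j S * jwSign j S = 1 := by
  rw [jwSign, ← mul_pow]; simp

theorem occSign_mul_self (j : Fin L) (S : Finset (Fin L)) : occSign j S * occSign j S = 1 := by
  unfold occSign; split_ifs <;> norm_num

theorem occSign_flip_self (j : Fin L) (S : Finset (Fin L)) :
    occSign j (S ∆ {j}) = -occSign j S := by
  by_cases h : j ∈ S <;> simp [occSign, Finset.mem_symmDiff, h]

theorem occSign_flip_of_ne {i j : Fin L} (hij : i ≠ j) (S : Finset (Fin L)) :
    occSign j (S ∆ {i}) = occSign j S := by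
  by_cases h : j ∈ S <;> simp [occSign, Finset.mem_symmDiff, h, hij.symm]

theorem jwSign_flip_of_le {i j : Fin L} (hij : j ≤ i) (S : Finset (Fin L)) :
    jwSign j (S ∆ {i}) = jwSign j S := by
  unfold jwSign
  congr 2
  ext k
  simp only [Finset.mem_filter, Finset.mem_symmDiff, Finset.mem_singleton]
  have : k < j → k ≠ i := fun h => (h.trans_le hij).ne
  tauto

theorem symmDiff_singleton_of_mem {i : Fin L} {S : Finset (Fin L)} (h : i ∈ S) :
    S ∆ {i} = S.erase i := by
  ext k
  simp only [Finset.mem_symmDiff, Finset.mem_singleton, Finset.mem_erase]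
  by_cases hk : k = i <;> simp_all

theorem symmDiff_singleton_of_notMem {i : Fin L} {S : Finset (Fin L)} (h : i ∉ S) :
    S ∆ {i} = insert i S := by
  ext k
  simp only [Finset.mem_symmDiff, Finset.mem_singleton, Finset.mem_insert]
  by_cases hk : k = i <;> simp_all

theorem neg_one_pow_card_flip (i : Fin L) (S : Finset (Fin L)) :
    (-1 : ℝ) ^ (S ∆ {i}).card = -(-1) ^ S.card := by
  by_cases h : i ∈ S
  · rw [symmDiff_singleton_of_mem h, ← Finset.card_erase_add_one h, pow_succ]; ring
  · rw [symmDiff_singleton_of_notMem h, Finset.card_insert_of_notMem h, pow_succ]; ring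

theorem jwSign_flip_of_lt {i j : Fin L} (hij : i < j) (S : Finset (Fin L)) :
    jwSign j (S ∆ {i}) = -jwSign j S := by
  unfold jwSign
  rw [← neg_one_pow_card_flip i]
  congr 2
  ext k
  simp only [Finset.mem_filter, Finset.mem_symmDiff, Finset.mem_singleton]
  by_cases h : k = i
  · subst h; tauto
  · tauto

/-- The sign strings of neighbours differ only by the factor of the site `i`; hence strings cancel
in all nearest-neighbour terms. -/
theorem jwSign_succ {i j : Fin L} (hij : (i : ℕ) + 1 = j) (S : Finset (Fin L)) :
    jwSign j S = jwSign i S * occSign i S := by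
  have hlt : ∀ k : Fin L, k < j ↔ k < i ∨ k = i := fun k => by
    rw [Fin.lt_def, Fin.lt_def, Fin.ext_iff]; omega
  unfold jwSign occSign
  simp only [hlt, Finset.filter_or]
  split_ifs with h
  · have : S.filter (fun k => k = i) = {i} := by
      ext k; simp only [Finset.mem_filter, Finset.mem_singleton]
      exact ⟨fun h => h.2, fun hk => ⟨hk ▸ h, hk⟩⟩
    rw [this, Finset.card_union_of_disjoint (by simp), Finset.card_singleton, pow_succ]
  · have : S.filter (fun k => k = i) = ∅ := by
      ext k; simp only [Finset.mem_filter, Finset.notMem_empty, iff_false, not_and]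
      rintro hk rfl; exact h hk
    rw [this, Finset.union_empty, mul_one]

/-- The Majorana operator `c_j + c_j†`. -/
def majA (j : Fin L) : Module.End ℂ (Fock L) := flipOp {j} (jwSign j)

/-- The Majorana operator `c_j - c_j†`. -/
def majB (j : Fin L) : Module.End ℂ (Fock L) := flipOp {j} fun S => occSign j S * jwSign j S

/-- Flipping the site `i` reverses the string of every later site and of no other. For two distinct
sites exactly one order of the product picks up this sign; on a single site the sign comes from
`occSign`. -/
theorem isMajorana : IsMajorana (majA (L := L)) majB where
  aa i j := by
    ext v S
    simp only [LinearMap.add_apply, Module.End.mul_apply, majA, flipOp_apply, PiLp.add_apply]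
    rcases lt_trichotomy i j with h | rfl | h
    · rw [if_neg h.ne, jwSign_flip_of_lt h, jwSign_flip_of_le h.le, symmDiff_right_comm S {j} {i}]
      simp; ring
    · rw [if_pos rfl, jwSign_flip_of_le le_rfl, symmDiff_symmDiff_cancel_right, ← mul_assoc,
        ← Complex.ofReal_mul, jwSign_mul_self]
      simp [Module.algebraMap_end_apply]; ring
    · rw [if_neg h.ne', jwSign_flip_of_lt h, jwSign_flip_of_le h.le, symmDiff_right_comm S {j} {i}]
      simp; ring
  bb i j := by
    ext v S
    simp only [LinearMap.add_apply, Module.End.mul_apply, majB, flipOp_apply, PiLp.add_apply]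
    rcases lt_trichotomy i j with h | rfl | h
    · rw [if_neg h.ne, jwSign_flip_of_lt h, jwSign_flip_of_le h.le, symmDiff_right_comm S {j} {i},
        occSign_flip_of_ne h.ne, occSign_flip_of_ne h.ne']
      simp; ring
    · have h1 : (jwSign i S : ℂ) * jwSign i S = 1 := by exact_mod_cast jwSign_mul_self i S
      have h2 : (occSign i S : ℂ) * occSign i S = 1 := by exact_mod_cast occSign_mul_self i S
      rw [if_pos rfl, jwSign_flip_of_le le_rfl, symmDiff_symmDiff_cancel_right,
        occSign_flip_self]
      simp [Module.algebraMap_end_apply]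
      linear_combination (-2 * v S * ((occSign i S : ℂ) * occSign i S)) * h1 - 2 * v S * h2
    · rw [if_neg h.ne', jwSign_flip_of_lt h, jwSign_flip_of_le h.le, symmDiff_right_comm S {j} {i},
        occSign_flip_of_ne h.ne, occSign_flip_of_ne h.ne']
      simp; ring
  ab i j := by
    ext v S
    simp only [LinearMap.add_apply, Module.End.mul_apply, majA, majB, flipOp_apply, PiLp.add_apply]
    rcases lt_trichotomy i j with h | rfl | h
    · rw [jwSign_flip_of_lt h, jwSign_flip_of_le h.le, symmDiff_right_comm S {j} {i},
        occSign_flip_of_ne h.ne]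
      simp; ring
    · rw [jwSign_flip_of_le le_rfl, occSign_flip_self]
      simp; ring
    · rw [jwSign_flip_of_lt h, jwSign_flip_of_le h.le, symmDiff_right_comm S {j} {i},
        occSign_flip_of_ne h.ne']
      simp; ring
  a_symm i x y := by
    simp only [majA, inner_flipOp, jwSign_flip_of_le le_rfl]
  b_skew i x y := by
    rw [majB, inner_flipOp, ← inner_neg_right]
    congr 1
    ext S
    simp [flipOp_apply, jwSign_flip_of_le le_rfl, occSign_flip_self]

/-- The number operator on the Fock space. -/
def numberOp (L : ℕ) : Module.End ℂ (Fock L) := flipOp ∅ fun S => S.card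

theorem numberOp_apply (v : Fock L) (S : Finset (Fin L)) :
    numberOp L v S = (S.card : ℂ) * v S := by
  rw [numberOp, flipOp_apply, ← Finset.bot_eq_empty, symmDiff_bot]
  simp

theorem majA_majB_apply_self (i : Fin L) (v : Fock L) (S : Finset (Fin L)) :
    majA i (majB i v) S = -(occSign i S : ℂ) * v S := by
  rw [majA, majB, flipOp_apply, flipOp_apply, occSign_flip_self, jwSign_flip_of_le le_rfl,
    symmDiff_symmDiff_cancel_right]
  have h1 : (jwSign i S : ℂ) * jwSign i S = 1 := by exact_mod_cast jwSign_mul_self i S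
  push_cast
  linear_combination (-occSign i S * v S) * h1

theorem sum_occSign (S : Finset (Fin L)) : ∑ i, occSign i S = L - 2 * S.card := by
  have : ∀ i, occSign i S = 1 - 2 * (if i ∈ S then 1 else 0) := fun i => by
    unfold occSign; split_ifs <;> norm_num
  simp [this, Finset.sum_sub_distrib, mul_comm]

/-- Each `a_i b_i` is diagonal with value `-occSign`, that is `2 n_i - 1`, so the sum is `2 N_w -
L`. -/
theorem bilinear_one_apply (v : Fock L) (S : Finset (Fin L)) :
    bilinear 1 majA majB v S = (2 * S.card - L : ℂ) * v S := by
  have h : bilinear (1 : Matrix (Fin L) (Fin L) ℝ) majA majB = ∑ i, majA i * majB i := by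
    simp only [bilinear, Matrix.one_apply]
    refine Finset.sum_congr rfl fun i _ => ?_
    rw [Finset.sum_eq_single i (fun j _ hj => by rw [if_neg hj.symm]; simp) (by simp)]
    simp
  have h2 : ((∑ i, occSign i S : ℝ) : ℂ) = L - 2 * S.card := by rw [sum_occSign]; simp
  rw [h, LinearMap.sum_apply, WithLp.ofLp_sum, Finset.sum_apply]
  simp only [Module.End.mul_apply, majA_majB_apply_self, ← Finset.sum_mul, Finset.sum_neg_distrib]
  rw [← Complex.ofReal_sum, h2]
  ring

/-- The matrix of the quadratic form of the wire in terms of the Majorana operators. -/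
def couplings (L : ℕ) (t Δ x : ℝ) : Matrix (Fin L) (Fin L) ℝ := fun i j =>
  (if (i : ℕ) + 1 = j then -(t + Δ) / 4 else 0) + (if (j : ℕ) + 1 = i then (Δ - t) / 4 else 0)
    + -(x / 2) * (1 : Matrix (Fin L) (Fin L) ℝ) i j

/-- The Hamiltonian of the wire on the Fock space. -/
def kitaev (L : ℕ) (t Δ x : ℝ) : Module.End ℂ (Fock L) := bilinear (couplings L t Δ x) majA majB

/-- The amplitude of flipping two neighbouring occupations. -/
def bondCoef (t Δ : ℝ) (i j : Fin L) (S : Finset (Fin L)) : ℝ :=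
  -(t / 4) * (1 - occSign i S * occSign j S) + Δ / 4 * (1 + occSign i S * occSign j S)

/-- Explicit matrix elements without strings. They serve both the comparison with `hamZero` and the
Perron–Frobenius argument. -/
theorem kitaev_apply (t Δ x : ℝ) (v : Fock L) (S : Finset (Fin L)) :
    kitaev L t Δ x v S = (∑ i : Fin L, ∑ j : Fin L, if (i : ℕ) + 1 = j then
      (bondCoef t Δ i j S : ℂ) * v (S ∆ {i} ∆ {j}) else 0) - (x : ℂ) * (S.card - L / 2) * v S := by
  have hsplit : kitaev L t Δ x = (∑ i : Fin L, ∑ j : Fin L, if (i : ℕ) + 1 = j then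
      ((-(t + Δ) / 4 : ℝ) : ℂ) • (majA i * majB j) + (((Δ - t) / 4 : ℝ) : ℂ) • (majA j * majB i)
        else 0) + ((-(x / 2) : ℝ) : ℂ) • bilinear 1 majA majB := by
    have h1 : (∑ i : Fin L, ∑ j : Fin L, if (i : ℕ) + 1 = j then
        (((Δ - t) / 4 : ℝ) : ℂ) • (majA j * majB i) else 0) = ∑ i : Fin L, ∑ j : Fin L,
        if (j : ℕ) + 1 = i then (((Δ - t) / 4 : ℝ) : ℂ) • (majA i * majB j) else 0 :=
      Finset.sum_comm
    have h2 : ∀ i j : Fin L, (if (i : ℕ) + 1 = j then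
        ((-(t + Δ) / 4 : ℝ) : ℂ) • (majA i * majB j) + (((Δ - t) / 4 : ℝ) : ℂ) • (majA j * majB i)
        else 0) = (if (i : ℕ) + 1 = j then ((-(t + Δ) / 4 : ℝ) : ℂ) • (majA i * majB j) else 0) +
        (if (i : ℕ) + 1 = j then (((Δ - t) / 4 : ℝ) : ℂ) • (majA j * majB i) else 0) := by
      intro i j; split_ifs <;> simp
    simp only [h2, Finset.sum_add_distrib, h1]
    simp only [kitaev, bilinear, Finset.smul_sum, ← Finset.sum_add_distrib]
    refine Finset.sum_congr rfl fun i _ => Finset.sum_congr rfl fun j _ => ?_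
    rw [couplings, Complex.ofReal_add, Complex.ofReal_add, add_smul, add_smul, smul_smul,
      ← Complex.ofReal_mul]
    split_ifs <;> simp
  rw [hsplit, LinearMap.add_apply, PiLp.add_apply, LinearMap.smul_apply, PiLp.smul_apply,
    bilinear_one_apply]
  refine (congrArg₂ (fun y z : ℂ => y + z) ?_ ?_).trans (sub_eq_add_neg _ _).symm
  · simp only [LinearMap.sum_apply, WithLp.ofLp_sum, Finset.sum_apply]
    refine Finset.sum_congr rfl fun i _ => Finset.sum_congr rfl fun j _ => ?_
    split_ifs with hij
    · have hlt : i < j := by rw [Fin.lt_def]; omega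
      have h1 : (jwSign i S : ℂ) * jwSign i S = 1 := by exact_mod_cast jwSign_mul_self i S
      have h2 : (occSign i S : ℂ) * occSign i S = 1 := by exact_mod_cast occSign_mul_self i S
      simp only [LinearMap.add_apply, LinearMap.smul_apply, PiLp.add_apply, PiLp.smul_apply,
        Module.End.mul_apply, majA, majB, flipOp_apply, symmDiff_right_comm S {j} {i},
        jwSign_flip_of_le hlt.le, jwSign_flip_of_le le_rfl, occSign_flip_of_ne hlt.ne,
        occSign_flip_of_ne hlt.ne', occSign_flip_self, jwSign_succ hij, smul_eq_mul, bondCoef]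
      push_cast
      linear_combination (((t + Δ) / 4 * occSign i S * occSign j S + (Δ - t) / 4 * occSign i S
        * occSign i S) * v (S ∆ {i} ∆ {j})) * h1 + ((Δ - t) / 4 * v (S ∆ {i} ∆ {j})) * h2
    · rfl
  · push_cast
    rw [smul_eq_mul]
    ring

end Fock

/-! ### Identification of the `M`-particle sector with a parity sector of the wire -/

section Transfer

open scoped symmDiff

variable {L : ℕ}

theorem ofBasis_ket (F : Finset (Fin L) → ℤ → State L) (S : Finset (Fin L)) (p : ℤ) :
    ofBasis F (ket S p) = F S p := by
  simp [ofBasis, ket]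

theorem ket_apply (S : Finset (Fin L)) (p : ℤ) (b : Config L) :
    ket S p b = if (S, p) = b then 1 else 0 := by
  rw [ket, Finsupp.single_apply]

theorem ann_ket (j : Fin L) (S : Finset (Fin L)) (p : ℤ) :
    ann j (ket S p) = if j ∈ S then (jwSign j S : ℂ) • ket (S ∆ {j}) p else 0 := by
  rw [ann, ofBasis_ket]
  split_ifs with h
  · rw [symmDiff_singleton_of_mem h, fermiSign, jwSign]; simp
  · rfl

theorem cre_ket (j : Fin L) (S : Finset (Fin L)) (p : ℤ) :
    cre j (ket S p) = if j ∈ S then 0 else (jwSign j S : ℂ) • ket (S ∆ {j}) p := by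
  rw [cre, ofBasis_ket]
  split_ifs with h
  · rfl
  · rw [symmDiff_singleton_of_notMem h, fermiSign, jwSign]; simp

theorem phaseUp_ket (S : Finset (Fin L)) (p : ℤ) : phaseUp L (ket S p) = ket S (p + 1) :=
  ofBasis_ket _ _ _

theorem phaseDown_ket (S : Finset (Fin L)) (p : ℤ) : phaseDown L (ket S p) = ket S (p - 1) :=
  ofBasis_ket _ _ _

theorem pairNumber_ket (S : Finset (Fin L)) (p : ℤ) :
    pairNumber L (ket S p) = (p : ℂ) • ket S p :=
  ofBasis_ket _ _ _

theorem mem_flip_self {j : Fin L} {S : Finset (Fin L)} : j ∈ S ∆ {j} ↔ j ∉ S := by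
  simp [Finset.mem_symmDiff]

theorem mem_flip_of_ne {i j : Fin L} (h : i ≠ j) {S : Finset (Fin L)} : i ∈ S ∆ {j} ↔ i ∈ S := by
  simp [Finset.mem_symmDiff, h]

theorem wireNumber_ket (S : Finset (Fin L)) (p : ℤ) :
    wireNumber L (ket S p) = (S.card : ℂ) • ket S p := by
  have h : ∀ j : Fin L, (cre j * ann j) (ket S p) = (if j ∈ S then (1 : ℂ) else 0) • ket S p := by
    intro j
    rw [Module.End.mul_apply, ann_ket]
    split_ifs with hj
    · rw [map_smul, cre_ket, if_neg (by simpa [mem_flip_self] using hj),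
        jwSign_flip_of_le le_rfl, symmDiff_symmDiff_cancel_right, smul_smul,
        ← Complex.ofReal_mul, jwSign_mul_self, Complex.ofReal_one]
    · simp
  rw [wireNumber, LinearMap.sum_apply, Finset.sum_congr rfl fun j _ => h j, ← Finset.sum_smul]
  simp

theorem totalNumber_ket (S : Finset (Fin L)) (p : ℤ) :
    totalNumber L (ket S p) = ((S.card + 2 * p : ℤ) : ℂ) • ket S p := by
  rw [totalNumber, LinearMap.add_apply, LinearMap.smul_apply, wireNumber_ket, pairNumber_ket,
    smul_smul, ← add_smul]
  push_cast
  rfl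

/-- A diagonal operator acts on coefficients by multiplication. -/
theorem diagonal_apply {A : Op L} {d : Finset (Fin L) → ℤ → ℂ}
    (hA : ∀ S p, A (ket S p) = d S p • ket S p) (ψ : State L) (b : Config L) :
    A ψ b = d b.1 b.2 * ψ b := by
  induction ψ using Finsupp.induction_linear with
  | zero => simp
  | add f g hf hg => rw [map_add, Finsupp.add_apply, hf, hg, Finsupp.add_apply, mul_add]
  | single a z =>
    have : Finsupp.single a z = z • ket a.1 a.2 := by rw [ket]; simp
    rw [this, map_smul, hA, smul_smul, Finsupp.smul_apply, Finsupp.smul_apply, ket_apply]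
    split_ifs with h
    · subst h; simp [mul_comm]
    · simp

theorem mem_sector_iff {M : ℤ} {ψ : State L} :
    ψ ∈ sector L M ↔ ∀ b : Config L, ψ b ≠ 0 → (b.1.card : ℤ) + 2 * b.2 = M := by
  rw [sector, Module.End.mem_eigenspace_iff, Finsupp.ext_iff]
  refine forall_congr' fun b => ?_
  rw [diagonal_apply totalNumber_ket, Finsupp.smul_apply, smul_eq_mul, mul_eq_mul_right_iff,
    Int.cast_inj]
  tauto

/-- The states of the wire whose particle number has the parity of `M`. -/
def paritySector (L : ℕ) (M : ℤ) : Submodule ℂ (Fock L) where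
  carrier := {v | ∀ S, ¬Even (M - (S.card : ℤ)) → v S = 0}
  add_mem' hv hw S hS := by simp [hv S hS, hw S hS]
  zero_mem' S _ := rfl
  smul_mem' c v hv S hS := by simp [hv S hS]

/-- Complete a state of the wire with Cooper pairs to `M` particles in total. -/
def embed (L : ℕ) (M : ℤ) : Fock L →ₗ[ℂ] State L where
  toFun v := ∑ S, v S • ket S ((M - S.card) / 2)
  map_add' v w := by simp [add_smul, Finset.sum_add_distrib]
  map_smul' c v := by simp [mul_smul, Finset.smul_sum]

theorem embed_eq (M : ℤ) (v : Fock L) : embed L M v = ∑ S, v S • ket S ((M - S.card) / 2) := rfl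

theorem embed_apply (M : ℤ) (v : Fock L) (b : Config L) :
    embed L M v b = if b.2 = (M - b.1.card) / 2 then v b.1 else 0 := by
  rw [embed_eq, Finsupp.finsetSum_apply]
  simp only [Finsupp.smul_apply, ket_apply, smul_eq_mul, mul_ite, mul_one, mul_zero]
  rw [Finset.sum_eq_single b.1]
  · refine if_congr ?_ rfl rfl
    rw [Prod.ext_iff]
    exact ⟨fun h => h.2.symm, fun h => ⟨rfl, h.symm⟩⟩
  · intro S _ hS
    rw [if_neg]
    rintro rfl
    exact hS rfl
  · simp

theorem embed_injective (M : ℤ) : Function.Injective (embed L M) := by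
  intro v w h
  ext S
  have := DFunLike.congr_fun h (S, (M - S.card) / 2)
  simpa [embed_apply] using this

/-- The total number fixes the number of pairs as `(M - |S|) / 2`; the integer division in `embed`
is exact precisely for the parities allowed in `paritySector`. -/
theorem map_embed_paritySector (M : ℤ) : (paritySector L M).map (embed L M) = sector L M := by
  ext ψ
  rw [Submodule.mem_map, mem_sector_iff]
  constructor
  · rintro ⟨v, hv, rfl⟩ b hb
    rw [embed_apply] at hb
    split_ifs at hb with h
    · have := mt (hv b.1) hb
      rw [not_not] at this
      have := Int.ediv_two_mul_two_of_even this
      omega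
    · exact absurd rfl hb
  · intro h
    refine ⟨WithLp.toLp 2 fun S => ψ (S, (M - S.card) / 2), fun S hS => ?_, ?_⟩
    · by_contra h0
      have h1 := h (S, (M - S.card) / 2) h0
      exact hS ⟨(M - S.card) / 2, by simp only at h1; omega⟩
    · ext b
      rw [embed_apply]
      split_ifs with hb
      · simp [← hb]
      · by_contra h0
        have := h b (Ne.symm h0)
        omega

theorem braket_embed (M : ℤ) (v w : Fock L) :
    braket (embed L M v) (embed L M w) = inner ℂ v w := by
  rw [braket, Finsupp.sum_of_support_subset (s := Finset.univ.image fun S : Finset (Fin L) =>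
    ((S, (M - S.card) / 2) : Config L))]
  · rw [Finset.sum_image (fun S _ T _ h => (Prod.ext_iff.mp h).1), PiLp.inner_apply]
    refine Finset.sum_congr rfl fun S _ => ?_
    simp [embed_apply, RCLike.inner_apply, mul_comm]
  · intro b hb
    rw [Finsupp.mem_support_iff, embed_apply] at hb
    split_ifs at hb with h
    · exact Finset.mem_image.mpr ⟨b.1, Finset.mem_univ _, Prod.ext rfl h.symm⟩
    · exact absurd rfl hb
  · simp

theorem diagonal_embed {M : ℤ} {A : Op L} {d : Finset (Fin L) → ℤ → ℂ}
    (hA : ∀ S p, A (ket S p) = d S p • ket S p) (v : Fock L) :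
    A (embed L M v) =
      embed L M (WithLp.toLp 2 fun S => d S ((M - S.card) / 2) * v S) := by
  ext b
  rw [diagonal_apply hA, embed_apply, embed_apply]
  split_ifs with h
  · simp [← h]
  · simp

theorem wireNumber_embed (M : ℤ) (v : Fock L) :
    wireNumber L (embed L M v) = embed L M (numberOp L v) := by
  rw [diagonal_embed wireNumber_ket]
  congr 1
  ext S
  rw [numberOp_apply]

/-- The charging energy as an operator on the Fock space of the wire, given `M` particles. -/
def chargeOp (L : ℕ) (𝓔c nc : ℝ) (M : ℤ) : Module.End ℂ (Fock L) :=
  flipOp ∅ fun S => 𝓔c / L * (M - S.card - 2 * nc) ^ 2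

theorem chargeOp_apply (𝓔c nc : ℝ) (M : ℤ) (v : Fock L) (S : Finset (Fin L)) :
    chargeOp L 𝓔c nc M v S = ((𝓔c / L * (M - S.card - 2 * nc) ^ 2 : ℝ) : ℂ) * v S := by
  rw [chargeOp, flipOp_apply, ← Finset.bot_eq_empty, symmDiff_bot]

theorem charging_ket (𝓔c nc : ℝ) (S : Finset (Fin L)) (p : ℤ) :
    charging L 𝓔c nc (ket S p) = ((𝓔c / L * (2 * p - 2 * nc) ^ 2 : ℝ) : ℂ) • ket S p := by
  have h : ((2 : ℂ) • pairNumber L - ((2 * nc : ℝ) : ℂ) • (1 : Op L)) (ket S p) =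
      ((2 * p - 2 * nc : ℝ) : ℂ) • ket S p := by
    rw [LinearMap.sub_apply, LinearMap.smul_apply, LinearMap.smul_apply, pairNumber_ket,
      Module.End.one_apply, smul_smul, ← sub_smul]
    push_cast
    rfl
  rw [charging, LinearMap.smul_apply, pow_two, Module.End.mul_apply, h, map_smul, h, smul_smul,
    smul_smul]
  congr 1
  push_cast
  ring

theorem charging_embed (𝓔c nc : ℝ) {M : ℤ} {v : Fock L} (hv : v ∈ paritySector L M) :
    charging L 𝓔c nc (embed L M v) = embed L M (chargeOp L 𝓔c nc M v) := by
  rw [diagonal_embed (charging_ket 𝓔c nc)]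
  congr 1
  ext S
  rw [chargeOp_apply]
  by_cases hS : Even (M - (S.card : ℤ))
  · have h : (2 * ((M - S.card) / 2 : ℤ) : ℝ) = M - S.card := by
      have := Int.two_mul_ediv_two_of_even hS
      exact_mod_cast congrArg (Int.cast : ℤ → ℝ) this
    simp only [h]
  · simp [hv S hS]

/-- The action of the Hamiltonian without charging energy on the basis vectors. -/
theorem hamZero_ket (t Δ x : ℝ) {M : ℤ} {S : Finset (Fin L)} (hS : Even (M - (S.card : ℤ))) :
    hamZero L t Δ x (ket S ((M - S.card) / 2)) =
      (∑ i : Fin L, ∑ j : Fin L, if (i : ℕ) + 1 = j then (bondCoef t Δ i j S : ℂ) •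
        ket (S ∆ {i} ∆ {j}) ((M - (S ∆ {i} ∆ {j}).card) / 2) else 0)
      - ((x : ℂ) * (S.card - L / 2)) • ket S ((M - S.card) / 2) := by
  have hdiag : ((x : ℂ) • (wireNumber L - ((L : ℂ) / 2) • (1 : Op L)))
      (ket S ((M - S.card) / 2)) = ((x : ℂ) * (S.card - L / 2)) • ket S ((M - S.card) / 2) := by
    rw [LinearMap.smul_apply, LinearMap.sub_apply, wireNumber_ket, LinearMap.smul_apply,
      Module.End.one_apply, ← sub_smul, smul_smul]
  rw [hamZero, LinearMap.sub_apply, hdiag, LinearMap.sub_apply, LinearMap.smul_apply,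
    LinearMap.smul_apply]
  congr 1
  simp only [LinearMap.sum_apply, Finset.smul_sum]
  simp only [← Finset.sum_sub_distrib]
  refine Finset.sum_congr rfl fun i _ => Finset.sum_congr rfl fun j _ => ?_
  split_ifs with hij
  swap
  · simp
  have hlt : i < j := by rw [Fin.lt_def]; omega
  have hs : (jwSign i S : ℂ) * jwSign i S = 1 := by exact_mod_cast jwSign_mul_self i S
  have hev := Int.two_mul_ediv_two_of_even hS
  simp only [LinearMap.add_apply, Module.End.mul_apply, ann_ket, cre_ket, phaseUp_ket]
  -- Four patterns on the bond: a pair enters the condensate (`p + 1`), a fermion hops either way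
  -- (`p` unchanged), or a pair leaves the condensate (`p - 1`).
  by_cases hi : i ∈ S <;> by_cases hj : j ∈ S
  · have hc : ((S ∆ {i} ∆ {j}).card : ℤ) + 2 = S.card := by
      rw [symmDiff_singleton_of_mem hi, symmDiff_singleton_of_mem (by simp [hj, hlt.ne']),
        Finset.card_erase_of_mem (by simp [hj, hlt.ne']), Finset.card_erase_of_mem hi]
      have := Finset.one_lt_card.mpr ⟨i, hi, j, hj, hlt.ne⟩
      omega
    have hp : (M - (S ∆ {i} ∆ {j}).card) / 2 = (M - S.card) / 2 + 1 := by omega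
    rw [hp]
    simp [-Complex.coe_smul, hi, hj, mem_flip_of_ne hlt.ne, mem_flip_of_ne hlt.ne', ann_ket, cre_ket,
      bondCoef, occSign, smul_smul, jwSign_flip_of_le hlt.le, jwSign_succ hij,
      symmDiff_right_comm S {j} {i}, ← neg_smul]
    congr 1
    linear_combination (Δ / 2 : ℂ) * hs
  · have hc : ((S ∆ {i} ∆ {j}).card : ℤ) = S.card := by
      rw [symmDiff_singleton_of_mem hi, symmDiff_singleton_of_notMem (by simp [hj]),
        Finset.card_insert_of_notMem (by simp [hj]), Finset.card_erase_add_one hi]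
    rw [hc]
    simp [-Complex.coe_smul, hi, hj, mem_flip_of_ne hlt.ne', cre_ket,
      bondCoef, occSign, smul_smul, jwSign_flip_of_lt hlt, jwSign_succ hij]
    congr 1
    linear_combination (t / 2 : ℂ) * hs
  · have hc : ((S ∆ {i} ∆ {j}).card : ℤ) = S.card := by
      rw [symmDiff_right_comm, symmDiff_singleton_of_mem hj,
        symmDiff_singleton_of_notMem (by simp [hi]),
        Finset.card_insert_of_notMem (by simp [hi]), Finset.card_erase_add_one hj]
    rw [hc]
    simp [-Complex.coe_smul, hi, hj, mem_flip_of_ne hlt.ne, mem_flip_of_ne hlt.ne', ann_ket, cre_ket,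
      bondCoef, occSign, smul_smul, jwSign_flip_of_le hlt.le, jwSign_succ hij,
      symmDiff_right_comm S {j} {i}]
    congr 1
    linear_combination (t / 2 : ℂ) * hs
  · have hc : ((S ∆ {i} ∆ {j}).card : ℤ) = S.card + 2 := by
      rw [symmDiff_singleton_of_notMem hi, symmDiff_singleton_of_notMem (by simp [hj, hlt.ne']),
        Finset.card_insert_of_notMem (by simp [hj, hlt.ne']), Finset.card_insert_of_notMem hi]
      push_cast
      ring
    have hp : (M - (S ∆ {i} ∆ {j}).card) / 2 = (M - S.card) / 2 - 1 := by omega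
    rw [hp]
    simp [-Complex.coe_smul, hi, hj, mem_flip_of_ne hlt.ne', cre_ket, phaseDown_ket,
      bondCoef, occSign, smul_smul, jwSign_flip_of_lt hlt, jwSign_succ hij, ← neg_smul]
    congr 1
    linear_combination (Δ / 2 : ℂ) * hs

theorem bondCoef_flip (t Δ : ℝ) {i j : Fin L} (hij : (i : ℕ) + 1 = j) (S : Finset (Fin L)) :
    bondCoef t Δ i j (S ∆ {i} ∆ {j}) = bondCoef t Δ i j S := by
  have hlt : i < j := by rw [Fin.lt_def]; omega
  unfold bondCoef
  rw [occSign_flip_self, occSign_flip_of_ne hlt.ne', occSign_flip_self, occSign_flip_of_ne hlt.ne]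
  ring

/-- Flipping the occupations of two sites is an involution. -/
theorem flip_flip_involutive (i j : Fin L) :
    Function.Involutive fun S : Finset (Fin L) => S ∆ {i} ∆ {j} := fun S => by
  dsimp only
  rw [symmDiff_right_comm (S ∆ {i}) {j} {i}, symmDiff_symmDiff_cancel_right,
    symmDiff_symmDiff_cancel_right]

theorem hamZero_embed (t Δ x : ℝ) {M : ℤ} {v : Fock L} (hv : v ∈ paritySector L M) :
    hamZero L t Δ x (embed L M v) = embed L M (kitaev L t Δ x v) := by
  have h1 : ∀ S, v S • hamZero L t Δ x (ket S ((M - S.card) / 2)) =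
      (∑ i : Fin L, ∑ j : Fin L, if (i : ℕ) + 1 = j then (v S * bondCoef t Δ i j S : ℂ) •
        ket (S ∆ {i} ∆ {j}) ((M - (S ∆ {i} ∆ {j}).card) / 2) else 0)
      - ((x : ℂ) * (S.card - L / 2) * v S) • ket S ((M - S.card) / 2) := by
    intro S
    by_cases hS : Even (M - (S.card : ℤ))
    · rw [hamZero_ket t Δ x hS, smul_sub, smul_smul, mul_comm (v S)]
      simp only [Finset.smul_sum, smul_ite, smul_zero, smul_smul]
    · simp [hv S hS]
  rw [embed_eq, embed_eq, map_sum]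
  simp only [map_smul, h1, kitaev_apply, sub_smul, Finset.sum_sub_distrib, Finset.sum_smul,
    ite_smul, zero_smul]
  congr 1
  calc _ = ∑ i : Fin L, ∑ j : Fin L, ∑ S : Finset (Fin L), if (i : ℕ) + 1 = j then
        (v S * bondCoef t Δ i j S : ℂ) •
        ket (S ∆ {i} ∆ {j}) ((M - (S ∆ {i} ∆ {j}).card) / 2) else 0 := by
        rw [Finset.sum_comm]
        exact Finset.sum_congr rfl fun i _ => Finset.sum_comm
    _ = ∑ i : Fin L, ∑ j : Fin L, ∑ S : Finset (Fin L), if (i : ℕ) + 1 = j then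
        (bondCoef t Δ i j S * v (S ∆ {i} ∆ {j}) : ℂ) • ket S ((M - S.card) / 2) else 0 := by
        refine Finset.sum_congr rfl fun i _ => Finset.sum_congr rfl fun j _ => ?_
        split_ifs with hij
        -- Reindexing by the double flip exchanges source and target; the amplitude is the same in
        -- both directions.
        · rw [← Equiv.sum_comp (flip_flip_involutive i j).toPerm]
          refine Finset.sum_congr rfl fun S _ => ?_
          have := flip_flip_involutive i j S
          dsimp only at this
          simp only [Function.Involutive.coe_toPerm, this, bondCoef_flip t Δ hij]
          rw [mul_comm]
        · rfl
    _ = _ := by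
        symm
        rw [Finset.sum_comm]
        exact Finset.sum_congr rfl fun i _ => Finset.sum_comm

theorem finrank_map_embed {M : ℤ} (W : Submodule ℂ (paritySector L M)) :
    Module.finrank ℂ (W.map ((embed L M) ∘ₗ (paritySector L M).subtype)) = Module.finrank ℂ W := by
  have h : Function.Injective ((embed L M) ∘ₗ (paritySector L M).subtype) := by
    rw [LinearMap.coe_comp]
    exact (embed_injective M).comp (paritySector L M).injective_subtype
  exact (Submodule.equivMapOfInjective _ h W).finrank_eq.symm

/-! ### Transport of eigenspaces and levels -/

section Level

variable {M : ℤ} {H : Op L} {T : paritySector L M →ₗ[ℂ] paritySector L M}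
  (hHT : ∀ v : paritySector L M, H (embed L M v) = embed L M (T v))
include hHT

theorem eigenspace_inf_sector (z : ℂ) : Module.End.eigenspace H z ⊓ sector L M =
    (Module.End.eigenspace T z).map ((embed L M) ∘ₗ (paritySector L M).subtype) := by
  ext ψ
  rw [Submodule.mem_inf, Submodule.mem_map, Module.End.mem_eigenspace_iff,
    ← map_embed_paritySector, Submodule.mem_map]
  constructor
  · rintro ⟨h, v, hv, rfl⟩
    refine ⟨⟨v, hv⟩, ?_, rfl⟩
    rw [Module.End.mem_eigenspace_iff]
    apply Subtype.ext
    apply embed_injective M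
    rw [← hHT ⟨v, hv⟩, h, ← map_smul]
    rfl
  · rintro ⟨v, hv, rfl⟩
    rw [Module.End.mem_eigenspace_iff] at hv
    refine ⟨?_, v, v.2, rfl⟩
    rw [LinearMap.comp_apply, Submodule.subtype_apply, hHT, hv, ← map_smul]
    rfl

theorem lowSpace_eq_map (x : ℝ) : lowSpace H M x =
    (lowSpan (E := paritySector L M) T x).map ((embed L M) ∘ₗ (paritySector L M).subtype) := by
  simp only [lowSpace, lowSpan, eigenspace_inf_sector hHT, Submodule.map_iSup]

theorem level_eq_spectralLevel (k : ℕ) : level H M k = spectralLevel (E := paritySector L M) T k := by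
  have h : ∀ x, Module.finrank ℂ (lowSpace H M x) =
      Module.finrank ℂ (lowSpan (E := paritySector L M) T x) := fun x => by
    rw [lowSpace_eq_map hHT, finrank_map_embed]
  simp only [level, spectralLevel, h]

theorem finrank_groundSpace : Module.finrank ℂ (groundSpace H M) =
    Module.finrank ℂ (Module.End.eigenspace T ((spectralLevel (E := paritySector L M) T 0 : ℝ) : ℂ)) := by
  rw [groundSpace, level_eq_spectralLevel hHT, eigenspace_inf_sector hHT, finrank_map_embed]

end Level

end Transfer

/-! ### Uniqueness and number fluctuations of the ground state of fixed parity -/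

section Ground

open scoped symmDiff

variable {L : ℕ}

theorem card_flip_parity (M : ℤ) (i : Fin L) (S : Finset (Fin L)) :
    Even (M - ((S ∆ {i}).card : ℤ)) ↔ ¬Even (M - (S.card : ℤ)) := by
  by_cases h : i ∈ S
  · rw [symmDiff_singleton_of_mem h, ← Finset.card_erase_add_one h]
    push_cast
    grind
  · rw [symmDiff_singleton_of_notMem h, Finset.card_insert_of_notMem h]
    push_cast
    grind

theorem card_flip_flip_parity (M : ℤ) (i j : Fin L) (S : Finset (Fin L)) :
    Even (M - ((S ∆ {i} ∆ {j}).card : ℤ)) ↔ Even (M - (S.card : ℤ)) := by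
  rw [card_flip_parity, card_flip_parity, not_not]

theorem majA_majB_mem (M : ℤ) (i j : Fin L) {v : Fock L} (hv : v ∈ paritySector L M) :
    majA i (majB j v) ∈ paritySector L M := by
  intro S hS
  rw [majA, majB, flipOp_apply, flipOp_apply,
    hv _ (by rwa [card_flip_flip_parity]), mul_zero, mul_zero]

theorem bilinear_mem (M : ℤ) (X : Matrix (Fin L) (Fin L) ℝ) {v : Fock L}
    (hv : v ∈ paritySector L M) : bilinear X majA majB v ∈ paritySector L M := by
  simp only [bilinear, LinearMap.sum_apply, LinearMap.smul_apply, Module.End.mul_apply]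
  exact Submodule.sum_mem _ fun i _ => Submodule.sum_mem _ fun j _ =>
    Submodule.smul_mem _ _ (majA_majB_mem M i j hv)

theorem bilinear_isSymmetric (X : Matrix (Fin L) (Fin L) ℝ) :
    (bilinear X majA majB).IsSymmetric := by
  intro v w
  simp only [bilinear, LinearMap.sum_apply, LinearMap.smul_apply, Module.End.mul_apply,
    sum_inner, inner_sum, inner_smul_left, inner_smul_right, Complex.conj_ofReal]
  refine Finset.sum_congr rfl fun i _ => Finset.sum_congr rfl fun j _ => ?_
  rw [isMajorana.a_symm, isMajorana.b_skew, isMajorana.skew_apply_apply, inner_neg_right, neg_neg]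

/-- The Hamiltonian without charging energy, restricted to states of given parity. -/
def sectorHam (L : ℕ) (t Δ x : ℝ) (M : ℤ) : paritySector L M →ₗ[ℂ] paritySector L M :=
  (kitaev L t Δ x).restrict fun _ hv => bilinear_mem M _ hv

theorem coe_sectorHam (t Δ x : ℝ) (M : ℤ) (v : paritySector L M) :
    (sectorHam L t Δ x M v : Fock L) = kitaev L t Δ x v := rfl

theorem sectorHam_isSymmetric (t Δ x : ℝ) (M : ℤ) :
    LinearMap.IsSymmetric (𝕜 := ℂ) (E := paritySector L M) (sectorHam L t Δ x M) :=
  fun v w => bilinear_isSymmetric _ (v : Fock L) w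

theorem hamZero_embed_coe (t Δ x : ℝ) (M : ℤ) (v : paritySector L M) :
    hamZero L t Δ x (embed L M v) = embed L M (sectorHam L t Δ x M v) :=
  hamZero_embed t Δ x v.2

theorem flip_flip_ne {i j : Fin L} (h : i ≠ j) (S : Finset (Fin L)) : S ∆ {i} ∆ {j} ≠ S := by
  intro h2
  have : i ∈ S ∆ {i} ∆ {j} ↔ i ∈ S := by rw [h2]
  rw [mem_flip_of_ne h, mem_flip_self] at this
  tauto

theorem exists_parity (hL : 2 ≤ L) (M : ℤ) :
    ∃ S : Finset (Fin L), Even (M - (S.card : ℤ)) := by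
  by_cases h : Even (M - ((∅ : Finset (Fin L)).card : ℤ))
  · exact ⟨_, h⟩
  · exact ⟨_, (card_flip_parity M ⟨0, by omega⟩ ∅).mpr h⟩

theorem single_mem_paritySector {M : ℤ} {S : Finset (Fin L)} (hS : Even (M - (S.card : ℤ))) :
    EuclideanSpace.single S (1 : ℂ) ∈ paritySector L M := by
  intro T hT
  have : T ≠ S := by rintro rfl; exact hT hS
  simp [this]

theorem one_lt_finrank_paritySector (hL : 2 ≤ L) (M : ℤ) :
    1 < Module.finrank ℂ (paritySector L M) := by
  obtain ⟨S, hS⟩ := exists_parity hL M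
  let i : Fin L := ⟨0, by omega⟩
  let j : Fin L := ⟨1, by omega⟩
  have hij : i ≠ j := by simp [i, j]
  have hne := flip_flip_ne hij S
  have hS' := (card_flip_flip_parity M i j S).mpr hS
  have hli : LinearIndependent ℂ ![(⟨_, single_mem_paritySector hS⟩ : paritySector L M),
      ⟨_, single_mem_paritySector hS'⟩] := by
    rw [LinearIndependent.pair_iff]
    intro a b hab
    have h := congrArg (fun w : paritySector L M => (w : Fock L)) hab
    have h1 := congrArg (fun w : Fock L => w S) h
    have h2 := congrArg (fun w : Fock L => w (S ∆ {i} ∆ {j})) h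
    constructor
    · simpa [hne.symm] using h1
    · simpa [hne] using h2
  have := hli.fintype_card_le_finrank
  rw [Fintype.card_fin] at this
  exact this

/-- A gauge in which all amplitudes of the Hamiltonian are negative. -/
theorem exists_gauge {t Δ : ℝ} (ht : 0 < t) :
    ∃ g : Finset (Fin L) → ℝ, (∀ S, g S * g S = 1) ∧ ∀ i j : Fin L, (i : ℕ) + 1 = j → ∀ S,
      bondCoef t Δ i j S * (g S * g (S ∆ {i} ∆ {j})) = -|bondCoef t Δ i j S| := by
  rcases le_or_gt Δ 0 with hΔ | hΔ
  · refine ⟨fun _ => 1, fun _ => by norm_num, fun i j _ S => ?_⟩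
    have : bondCoef t Δ i j S ≤ 0 := by
      unfold bondCoef occSign
      split_ifs <;> linarith
    rw [abs_of_nonpos this]
    ring
  -- Hopping keeps `|S|` and already has amplitude `-t/2`; a pair term changes `|S|` by two, so this
  -- sign reverses exactly the positive amplitudes `Δ/2`.
  · refine ⟨fun S => (-1) ^ (S.card / 2), fun S => by rw [← mul_pow]; simp, fun i j hij S => ?_⟩
    have hne : i ≠ j := by rintro rfl; omega
    dsimp only
    by_cases hi : i ∈ S <;> by_cases hj : j ∈ S
    · have hc : (S ∆ {i} ∆ {j}).card + 2 = S.card := by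
        rw [symmDiff_singleton_of_mem hi, symmDiff_singleton_of_mem (by simp [hj, hne.symm]),
          Finset.card_erase_of_mem (by simp [hj, hne.symm]), Finset.card_erase_of_mem hi]
        have := Finset.one_lt_card.mpr ⟨i, hi, j, hj, hne⟩
        omega
      have h2 : S.card / 2 = (S ∆ {i} ∆ {j}).card / 2 + 1 := by omega
      have hb : bondCoef t Δ i j S = Δ / 2 := by simp [bondCoef, occSign, hi, hj]; ring
      rw [hb, h2, abs_of_pos (by linarith), pow_succ, mul_right_comm, ← mul_pow]
      simp
    · have hc : (S ∆ {i} ∆ {j}).card = S.card := by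
        rw [symmDiff_singleton_of_mem hi, symmDiff_singleton_of_notMem (by simp [hj]),
          Finset.card_insert_of_notMem (by simp [hj]), Finset.card_erase_add_one hi]
      have hb : bondCoef t Δ i j S = -(t / 2) := by simp [bondCoef, occSign, hi, hj]; ring
      rw [hb, hc, abs_of_neg (by linarith), ← mul_pow]
      simp
    · have hc : (S ∆ {i} ∆ {j}).card = S.card := by
        rw [symmDiff_right_comm, symmDiff_singleton_of_mem hj,
          symmDiff_singleton_of_notMem (by simp [hi]),
          Finset.card_insert_of_notMem (by simp [hi]), Finset.card_erase_add_one hj]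
      have hb : bondCoef t Δ i j S = -(t / 2) := by simp [bondCoef, occSign, hi, hj]; ring
      rw [hb, hc, abs_of_neg (by linarith), ← mul_pow]
      simp
    · have hc : (S ∆ {i} ∆ {j}).card = S.card + 2 := by
        rw [symmDiff_singleton_of_notMem hi,
          symmDiff_singleton_of_notMem (by simp [hj, hne.symm]),
          Finset.card_insert_of_notMem (by simp [hj, hne.symm]),
          Finset.card_insert_of_notMem hi]
      have h2 : (S ∆ {i} ∆ {j}).card / 2 = S.card / 2 + 1 := by omega
      have hb : bondCoef t Δ i j S = Δ / 2 := by simp [bondCoef, occSign, hi, hj]; ring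
      have hp : (-1 : ℝ) ^ (S.card / 2) * (-1) ^ (S.card / 2) = 1 := by rw [← mul_pow]; simp
      rw [hb, h2, abs_of_pos (by linarith), pow_succ]
      linear_combination (-(Δ / 2)) * hp

theorem bondCoef_ne_zero {t Δ : ℝ} (ht : 0 < t) (hΔ : Δ ≠ 0) (i j : Fin L)
    (S : Finset (Fin L)) : bondCoef t Δ i j S ≠ 0 := by
  unfold bondCoef occSign
  split_ifs <;> intro h
  · exact hΔ (by linarith)
  · linarith
  · linarith
  · exact hΔ (by linarith)

/-- Flips of neighbouring pairs connect any set of occupied sites to a subset of the first site. -/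
theorem exists_connected (Q : Finset (Fin L) → Prop)
    (hQ : ∀ i j : Fin L, (i : ℕ) + 1 = j → ∀ S, Q S → Q (S ∆ {i} ∆ {j})) (S : Finset (Fin L)) :
    ∃ C : Finset (Fin L), (∀ k ∈ C, (k : ℕ) = 0) ∧
      (∀ M : ℤ, Even (M - (C.card : ℤ)) ↔ Even (M - (S.card : ℤ))) ∧ (Q S ↔ Q C) := by
  -- The sum of the occupied site indices decreases: flipping the bond `(j - 1, j)` with `j`
  -- occupied removes `j` and at worst adds `j - 1`.
  induction hn : ∑ k ∈ S, (k : ℕ) using Nat.strong_induction_on generalizing S with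
  | _ n ih =>
    by_cases h : ∀ k ∈ S, (k : ℕ) = 0
    · exact ⟨S, h, fun _ => Iff.rfl, Iff.rfl⟩
    push Not at h
    obtain ⟨j, hj, hj0⟩ := h
    have hjL := j.2
    let i : Fin L := ⟨j - 1, by omega⟩
    have hij : (i : ℕ) + 1 = j := by simp only [i]; omega
    have hne : i ≠ j := by rintro h; rw [h] at hij; omega
    have hsum : ∑ k ∈ S ∆ {i} ∆ {j}, (k : ℕ) < n := by
      have h1 := Finset.sum_erase_add S (fun k : Fin L => (k : ℕ)) hj
      rw [symmDiff_right_comm, symmDiff_singleton_of_mem hj]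
      by_cases hi : i ∈ S.erase j
      · rw [symmDiff_singleton_of_mem hi]
        have h2 := Finset.sum_erase_add (S.erase j) (fun k : Fin L => (k : ℕ)) hi
        omega
      · rw [symmDiff_singleton_of_notMem hi, Finset.sum_insert hi]
        omega
    obtain ⟨C, hC, hpar, hQC⟩ := ih _ hsum _ rfl
    refine ⟨C, hC, fun M => by rw [hpar, card_flip_flip_parity], Iff.trans ⟨hQ i j hij S, ?_⟩ hQC⟩
    intro h
    have h2 := hQ i j hij _ h
    rwa [show S ∆ {i} ∆ {j} ∆ {i} ∆ {j} = S from flip_flip_involutive i j S] at h2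

/-- Both sets reduce to the empty set or the first site alone, and parity decides which; so the
flips act transitively on each parity class. -/
theorem connected (Q : Finset (Fin L) → Prop)
    (hQ : ∀ i j : Fin L, (i : ℕ) + 1 = j → ∀ S, Q S → Q (S ∆ {i} ∆ {j})) {M : ℤ}
    {S T : Finset (Fin L)} (hS : Even (M - (S.card : ℤ))) (hT : Even (M - (T.card : ℤ)))
    (h : Q S) : Q T := by
  obtain ⟨C, hC, hCp, hCQ⟩ := exists_connected Q hQ S
  obtain ⟨D, hD, hDp, hDQ⟩ := exists_connected Q hQ T
  have key : ∀ A B : Finset (Fin L), (∀ k ∈ A, (k : ℕ) = 0) → (∀ k ∈ B, (k : ℕ) = 0) →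
      Even (M - (A.card : ℤ)) → Even (M - (B.card : ℤ)) → A ⊆ B := by
    intro A B hA hB hAp hBp k hk
    have hA1 : A = {k} := Finset.eq_singleton_iff_unique_mem.mpr
      ⟨hk, fun l hl => Fin.ext ((hA l hl).trans (hA k hk).symm)⟩
    by_contra hkB
    have hB0 : B = ∅ := by
      rw [Finset.eq_empty_iff_forall_notMem]
      intro l hl
      rw [Fin.ext ((hB l hl).trans (hA k hk).symm)] at hl
      exact hkB hl
    rw [hA1, Finset.card_singleton] at hAp
    rw [hB0, Finset.card_empty] at hBp
    push_cast at *
    grind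
  have hCD : C = D := Finset.Subset.antisymm
    (key C D hC hD ((hCp M).mpr hS) ((hDp M).mpr hT))
    (key D C hD hC ((hDp M).mpr hT) ((hCp M).mpr hS))
  rwa [hDQ, ← hCD, ← hCQ]

/-- Passing to moduli with the gauge signs keeps the diagonal energy and makes every bond contribute
minus its absolute value, the least possible. -/
theorem inner_kitaev_gauge_le {t Δ x : ℝ} {g : Finset (Fin L) → ℝ} (hg : ∀ S, g S * g S = 1)
    (hgb : ∀ i j : Fin L, (i : ℕ) + 1 = j → ∀ S,
      bondCoef t Δ i j S * (g S * g (S ∆ {i} ∆ {j})) = -|bondCoef t Δ i j S|)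
    (v : Fock L) {u : Fock L} (hu : ∀ S, u S = ((g S * ‖v S‖ : ℝ) : ℂ)) :
    (inner ℂ u (kitaev L t Δ x u)).re ≤ (inner ℂ v (kitaev L t Δ x v)).re := by
  rw [PiLp.inner_apply, PiLp.inner_apply, Complex.re_sum, Complex.re_sum]
  refine Finset.sum_le_sum fun S _ => ?_
  rw [RCLike.inner_apply, RCLike.inner_apply, kitaev_apply, kitaev_apply, sub_mul, sub_mul,
    Finset.sum_mul, Finset.sum_mul, Complex.sub_re, Complex.sub_re, Complex.re_sum, Complex.re_sum]
  have hdiag : (((x : ℂ) * (S.card - L / 2) * u S) * conj (u S)).re =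
      (((x : ℂ) * (S.card - L / 2) * v S) * conj (v S)).re := by
    congr 1
    rw [mul_assoc _ (u S), mul_assoc _ (v S), Complex.mul_conj, Complex.mul_conj,
      Complex.normSq_eq_norm_sq,
      Complex.normSq_eq_norm_sq, hu, Complex.norm_real, norm_mul, norm_norm, mul_pow]
    have : ‖g S‖ ^ 2 = 1 := by rw [Real.norm_eq_abs, sq_abs, pow_two, hg]
    rw [this, one_mul]
  refine sub_le_sub (Finset.sum_le_sum fun i _ => ?_) hdiag.ge
  rw [Finset.sum_mul, Finset.sum_mul, Complex.re_sum, Complex.re_sum]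
  refine Finset.sum_le_sum fun j _ => ?_
  split_ifs with hij
  · have h1 : (bondCoef t Δ i j S : ℂ) * u (S ∆ {i} ∆ {j}) * conj (u S) =
        ((-|bondCoef t Δ i j S| * (‖v (S ∆ {i} ∆ {j})‖ * ‖v S‖) : ℝ) : ℂ) := by
      rw [← hgb i j hij S, hu, hu, Complex.conj_ofReal, ← Complex.ofReal_mul, ← Complex.ofReal_mul]
      congr 1
      ring
    rw [h1, Complex.ofReal_re]
    have h2 := Complex.abs_re_le_norm ((bondCoef t Δ i j S : ℂ) * v (S ∆ {i} ∆ {j}) * conj (v S))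
    rw [norm_mul, norm_mul, Complex.norm_real, Complex.norm_conj, Real.norm_eq_abs] at h2
    have h3 := neg_abs_le ((bondCoef t Δ i j S : ℂ) * v (S ∆ {i} ∆ {j}) * conj (v S)).re
    nlinarith
  · simp

section Sector

variable {t Δ : ℝ} (hL : 2 ≤ L) (ht : 0 < t) (hΔ : Δ ≠ 0) (x : ℝ) (M : ℤ)

/-- `v` is a ground state of the Hamiltonian without charging energy among states of given
parity. -/
def IsGround (t Δ x : ℝ) {M : ℤ} (v : paritySector L M) : Prop :=
  sectorHam L t Δ x M v = (spectralLevel (E := paritySector L M) (sectorHam L t Δ x M) 0 : ℂ) • v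

theorem IsGround.kitaev_eq {x : ℝ} {M : ℤ} {v : paritySector L M} (hv : IsGround t Δ x v) :
    kitaev L t Δ x v =
      (spectralLevel (E := paritySector L M) (sectorHam L t Δ x M) 0 : ℂ) • (v : Fock L) :=
  congrArg (fun w : paritySector L M => (w : Fock L)) hv

theorem IsGround.inner_kitaev {x : ℝ} {M : ℤ} {v : paritySector L M} (hv : IsGround t Δ x v) :
    (inner ℂ (v : Fock L) (kitaev L t Δ x v)).re =
      spectralLevel (E := paritySector L M) (sectorHam L t Δ x M) 0 * ‖v‖ ^ 2 := by
  rw [hv.kitaev_eq, inner_smul_right, inner_self_eq_norm_sq_to_K, Complex.re_ofReal_mul,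
    Submodule.coe_norm]
  congr 1
  exact Complex.ofReal_re (‖(v : Fock L)‖ ^ 2) ▸ by norm_cast

include hL in
theorem nontrivial_paritySector : Nontrivial (paritySector L M) :=
  Module.nontrivial_of_finrank_pos (one_pos.trans (one_lt_finrank_paritySector hL M))

variable {x M}

include hL in
theorem exists_isGround : ∃ v : paritySector L M, ‖v‖ = 1 ∧ IsGround t Δ x v := by
  have := nontrivial_paritySector hL M
  exact exists_ground_vector (sectorHam_isSymmetric t Δ x M)

include hL ht hΔ

/-- A Perron–Frobenius argument: ground states vanish nowhere. -/
theorem IsGround.eq_zero {v : paritySector L M} (hv : IsGround t Δ x v) {S : Finset (Fin L)}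
    (hS : Even (M - (S.card : ℤ))) (h0 : (v : Fock L) S = 0) : v = 0 := by
  have := nontrivial_paritySector hL M
  obtain ⟨g, hg, hgb⟩ := exists_gauge (L := L) (Δ := Δ) ht
  let u : paritySector L M := ⟨WithLp.toLp 2 fun S => ((g S * ‖(v : Fock L) S‖ : ℝ) : ℂ),
    fun S hS => by simp [v.2 S hS]⟩
  have hu : ∀ S, (u : Fock L) S = ((g S * ‖(v : Fock L) S‖ : ℝ) : ℂ) := fun S => rfl
  have hnorm : ‖u‖ ^ 2 = ‖v‖ ^ 2 := by
    rw [Submodule.coe_norm, Submodule.coe_norm, EuclideanSpace.norm_sq_eq,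
      EuclideanSpace.norm_sq_eq]
    refine Finset.sum_congr rfl fun S _ => ?_
    rw [hu, Complex.norm_real, norm_mul, norm_norm, mul_pow, Real.norm_eq_abs, sq_abs, pow_two,
      hg, one_mul]
  have hE : sectorHam L t Δ x M u = (spectralLevel (E := paritySector L M) (sectorHam L t Δ x M) 0 : ℂ) • u := by
    refine apply_eq_of_inner_le (sectorHam_isSymmetric t Δ x M) ?_
    rw [hnorm]
    exact (inner_kitaev_gauge_le hg hgb (v : Fock L) hu).trans hv.inner_kitaev.le
  -- At a zero of `v` the eigenvalue equation for `u` says that a sum of terms `|amplitude| *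
  -- ‖neighbouring coefficient‖` is zero. All amplitudes are nonzero, so the zero spreads to every
  -- neighbour.
  have hstep : ∀ i j : Fin L, (i : ℕ) + 1 = j → ∀ S, (v : Fock L) S = 0 →
      (v : Fock L) (S ∆ {i} ∆ {j}) = 0 := by
    intro i j hij S hS0
    have h1 := congrArg (fun w : paritySector L M => (w : Fock L) S) hE
    simp only [coe_sectorHam, Submodule.coe_smul, PiLp.smul_apply, kitaev_apply] at h1
    have hu0 : (u : Fock L) S = 0 := by simp [hu, hS0]
    rw [hu0, mul_zero, sub_zero, smul_zero] at h1
    have h2 : ∑ i : Fin L, ∑ j : Fin L, (if (i : ℕ) + 1 = j then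
        |bondCoef t Δ i j S| * ‖(v : Fock L) (S ∆ {i} ∆ {j})‖ else 0) = 0 := by
      have h3 : (g S : ℂ) * (∑ i : Fin L, ∑ j : Fin L, if (i : ℕ) + 1 = j then
          (bondCoef t Δ i j S : ℂ) * (u : Fock L) (S ∆ {i} ∆ {j}) else 0) =
          ((-∑ i : Fin L, ∑ j : Fin L, (if (i : ℕ) + 1 = j then
          |bondCoef t Δ i j S| * ‖(v : Fock L) (S ∆ {i} ∆ {j})‖ else 0) : ℝ) : ℂ) := by
        rw [← Finset.sum_neg_distrib, Complex.ofReal_sum, Finset.mul_sum]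
        refine Finset.sum_congr rfl fun i _ => ?_
        rw [← Finset.sum_neg_distrib, Complex.ofReal_sum, Finset.mul_sum]
        refine Finset.sum_congr rfl fun j _ => ?_
        split_ifs with hij
        · rw [hu, ← Complex.ofReal_mul, ← Complex.ofReal_mul, ← neg_mul, ← hgb i j hij S]
          congr 1
          ring
        · simp
      rw [h1, mul_zero] at h3
      have h4 := Complex.ofReal_eq_zero.mp h3.symm
      linarith
    have hnn : ∀ i j : Fin L, 0 ≤ (if (i : ℕ) + 1 = j then
        |bondCoef t Δ i j S| * ‖(v : Fock L) (S ∆ {i} ∆ {j})‖ else 0) := fun i j => by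
      split_ifs <;> positivity
    have h5 := (Finset.sum_eq_zero_iff_of_nonneg
      (fun i _ => Finset.sum_nonneg fun j _ => hnn i j)).mp h2 i (Finset.mem_univ i)
    have h6 := (Finset.sum_eq_zero_iff_of_nonneg (fun j _ => hnn i j)).mp h5 j (Finset.mem_univ j)
    rw [if_pos hij] at h6
    have h7 := (mul_eq_zero.mp h6).resolve_left
      (abs_ne_zero.mpr (bondCoef_ne_zero ht hΔ i j S))
    exact norm_eq_zero.mp h7
  apply Subtype.ext
  ext T
  by_cases hT : Even (M - (T.card : ℤ))
  · exact connected (fun S => (v : Fock L) S = 0) hstep hS hT h0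
  · exact v.2 T hT

/-- The ground state of given parity is unique up to a factor. -/
theorem IsGround.exists_eq_smul {v w : paritySector L M} (hv : IsGround t Δ x v)
    (hw : IsGround t Δ x w) (hv0 : v ≠ 0) : ∃ c : ℂ, w = c • v := by
  obtain ⟨S, hS⟩ := exists_parity hL M
  have hvS : (v : Fock L) S ≠ 0 := fun h => hv0 (hv.eq_zero hL ht hΔ hS h)
  -- With this factor `w - c • v` is a solution vanishing at `S`, hence zero.
  refine ⟨(w : Fock L) S / (v : Fock L) S, ?_⟩
  rw [← sub_eq_zero]
  refine IsGround.eq_zero (t := t) (Δ := Δ) (x := x) hL ht hΔ ?_ hS ?_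
  · unfold IsGround at *
    rw [map_sub, map_smul, hv, hw, smul_sub, smul_comm]
  · simp [hvS]

/-- The fluctuations of the particle number in the ground state are at most `L / 2`. -/
theorem IsGround.norm_number_sub_sq_le {v : paritySector L M} (hv : IsGround t Δ x v)
    (hv1 : ‖v‖ = 1) :
    ∃ c : ℝ, ‖numberOp L v - (c : ℂ) • (v : Fock L)‖ ^ 2 ≤ L / 2 := by
  obtain ⟨U, V, s, hU, hV, hB⟩ := exists_singular_value_decomposition (couplings L t Δ x)
  have hm := isMajorana.combine hU hV
  have hk : kitaev L t Δ x = bilinear (Matrix.diagonal s) (combine U majA) (combine V majB) := by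
    rw [bilinear_combine, ← hB]; rfl
  have hcomm : ∀ k, Commute (combine U majA k * combine V majB k) (kitaev L t Δ x) := by
    intro k
    rw [hk, bilinear]
    refine Commute.sum_right _ _ _ fun i _ => Commute.sum_right _ _ _ fun j _ => ?_
    by_cases hij : i = j
    · subst hij
      exact (hm.commute_pair k i).smul_right _
    · rw [Matrix.diagonal_apply_ne _ hij, Complex.ofReal_zero, zero_smul]
      exact Commute.zero_right _
  have hmem : ∀ k, (combine U majA k * combine V majB k) (v : Fock L) ∈ paritySector L M := by
    intro k
    simp only [combine, Module.End.mul_apply, LinearMap.sum_apply, LinearMap.smul_apply, map_sum,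
      map_smul]
    exact Submodule.sum_mem _ fun i _ => Submodule.smul_mem _ _ <|
      Submodule.sum_mem _ fun j _ => Submodule.smul_mem _ _ (majA_majB_mem M _ _ v.2)
  have hv0 : v ≠ 0 := by rintro rfl; simp at hv1
  -- Each mode commutes with the Hamiltonian and preserves parity, so it maps the ground state to a
  -- ground state, and uniqueness applies.
  have heig : ∀ k, ∃ c : ℂ, (combine U majA k * combine V majB k) (v : Fock L) =
      c • (v : Fock L) := by
    intro k
    have hw : IsGround t Δ x (⟨_, hmem k⟩ : paritySector L M) := by
      refine Subtype.ext ?_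
      have h1 := LinearMap.congr_fun (hcomm k).eq (v : Fock L)
      rw [Module.End.mul_apply, Module.End.mul_apply (kitaev L t Δ x), hv.kitaev_eq,
        map_smul] at h1
      rw [coe_sectorHam, Submodule.coe_smul]
      exact h1.symm
    obtain ⟨c, hc⟩ := hv.exists_eq_smul hL ht hΔ hw hv0
    exact ⟨c, congrArg (fun w : paritySector L M => (w : Fock L)) hc⟩
  obtain ⟨c, hc⟩ := isMajorana.norm_bilinear_one_sub_sq_le hU hV (ψ := (v : Fock L)) hv1 heig
  -- From `N_w = L/2 + (1/2) ∑ a_i b_i`; halving the operator divides the bound `2 L` by four.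
  refine ⟨L / 2 + c / 2, ?_⟩
  have h : numberOp L v - ((L / 2 + c / 2 : ℝ) : ℂ) • (v : Fock L) =
      (1 / 2 : ℂ) • (bilinear 1 majA majB (v : Fock L) - (c : ℂ) • (v : Fock L)) := by
    ext S
    simp only [PiLp.sub_apply, PiLp.smul_apply, numberOp_apply, bilinear_one_apply, smul_eq_mul]
    push_cast
    ring
  rw [h, norm_smul, mul_pow]
  rw [Fintype.card_fin] at hc
  have h4 : ‖(1 / 2 : ℂ)‖ ^ 2 = 1 / 4 := by norm_num
  rw [h4]
  linarith

end Sector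

end Ground

/-! ### Monotonicity and continuity of the filling, and the shifted potential -/

section Filling

open Filter Topology

variable {L : ℕ}

/-- The energy of a fixed state is affine in `x`, with slope given by the particle number; this
drives monotonicity, continuity and the completion of the square. -/
theorem re_inner_kitaev (t Δ x : ℝ) (v : Fock L) :
    (inner ℂ v (kitaev L t Δ x v)).re = (inner ℂ v (kitaev L t Δ 0 v)).re
      - x * ((inner ℂ v (numberOp L v)).re - L / 2 * ‖v‖ ^ 2) := by
  have h : kitaev L t Δ x v =
      kitaev L t Δ 0 v - (x : ℂ) • (numberOp L v - ((L / 2 : ℝ) : ℂ) • v) := by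
    ext S
    simp only [PiLp.sub_apply, PiLp.smul_apply, kitaev_apply, numberOp_apply, smul_eq_mul]
    push_cast
    ring
  have hv : (inner ℂ v v).re = ‖v‖ ^ 2 := inner_self_eq_norm_sq (𝕜 := ℂ) v
  rw [h, inner_sub_right, inner_smul_right, inner_sub_right, inner_smul_right, Complex.sub_re,
    Complex.re_ofReal_mul, Complex.sub_re, Complex.re_ofReal_mul, hv]

theorem mem_groundSpace_hamZero {t Δ x : ℝ} {M : ℤ} {χ : State L} :
    χ ∈ groundSpace (hamZero L t Δ x) M ↔
      ∃ w : paritySector L M, IsGround t Δ x w ∧ embed L M w = χ := by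
  rw [groundSpace, level_eq_spectralLevel (hamZero_embed_coe t Δ x M),
    eigenspace_inf_sector (hamZero_embed_coe t Δ x M), Submodule.mem_map]
  simp only [Module.End.mem_eigenspace_iff]
  rfl

variable {t Δ : ℝ} (hL : 2 ≤ L) (ht : 0 < t) (hΔ : Δ ≠ 0)
include hL

theorem IsGround.le_inner {x : ℝ} {M : ℤ} {v : paritySector L M} (hv : IsGround t Δ x v)
    (hv1 : ‖v‖ = 1) (w : paritySector L M) :
    (inner ℂ (v : Fock L) (kitaev L t Δ x v)).re * ‖w‖ ^ 2 ≤
      (inner ℂ (w : Fock L) (kitaev L t Δ x w)).re := by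
  have := nontrivial_paritySector hL M
  rw [hv.inner_kitaev, hv1, one_pow, mul_one]
  exact spectralLevel_zero_le_inner (sectorHam_isSymmetric t Δ x M) w

include ht hΔ

theorem IsGround.inner_number_eq {x : ℝ} {M : ℤ} {v w : paritySector L M}
    (hv : IsGround t Δ x v) (hw : IsGround t Δ x w) (hv1 : ‖v‖ = 1) (hw1 : ‖w‖ = 1) :
    (inner ℂ (w : Fock L) (numberOp L w)).re = (inner ℂ (v : Fock L) (numberOp L v)).re := by
  obtain ⟨c, rfl⟩ := hv.exists_eq_smul hL ht hΔ hw (by rintro rfl; simp at hv1)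
  rw [norm_smul, hv1, mul_one] at hw1
  rw [Submodule.coe_smul, map_smul, inner_smul_left, inner_smul_right, ← mul_assoc,
    Complex.conj_mul', hw1]
  simp

/-- Ground states differ only by a phase, so the arbitrary choice in `groundStateZero` does not
affect the expectation value. -/
theorem filling_eq {x : ℝ} {M : ℤ} {v : paritySector L M} (hv : IsGround t Δ x v)
    (hv1 : ‖v‖ = 1) : filling L t Δ M x = (inner ℂ (v : Fock L) (numberOp L v)).re := by
  have hex : ∃ χ : State L, χ ∈ groundSpace (hamZero L t Δ x) M ∧ braket χ χ = 1 := by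
    refine ⟨embed L M v, mem_groundSpace_hamZero.mpr ⟨v, hv, rfl⟩, ?_⟩
    rw [braket_embed, inner_self_eq_norm_sq_to_K, ← Submodule.coe_norm, hv1]
    simp
  obtain ⟨h1, h2⟩ := Classical.epsilon_spec hex
  obtain ⟨w, hw, hwχ⟩ := mem_groundSpace_hamZero.mp h1
  change groundStateZero L t Δ M x ∈ _ at h1
  change embed L M w = groundStateZero L t Δ M x at hwχ
  change braket (groundStateZero L t Δ M x) (groundStateZero L t Δ M x) = 1 at h2
  rw [← hwχ, braket_embed, inner_self_eq_norm_sq_to_K] at h2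
  have hw1 : ‖w‖ = 1 := by
    have h3 : ‖(w : Fock L)‖ ^ 2 = 1 := Complex.ofReal_injective (by push_cast; exact h2)
    rw [Submodule.coe_norm]
    exact (pow_eq_one_iff_of_nonneg (norm_nonneg _) two_ne_zero).mp h3
  rw [filling, ← hwχ, wireNumber_embed, braket_embed]
  exact hv.inner_number_eq hL ht hΔ hw hv1 hw1

/-- Each ground state is a trial state for the other potential; adding the two inequalities gives
`(y - x) (f y - f x) ≥ 0`. -/
theorem filling_mono (M : ℤ) : Monotone (filling L t Δ M) := by
  intro x y hxy
  rcases hxy.eq_or_lt with rfl | hlt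
  · exact le_rfl
  obtain ⟨v, hv1, hv⟩ := exists_isGround (t := t) (Δ := Δ) hL (x := x) (M := M)
  obtain ⟨w, hw1, hw⟩ := exists_isGround (t := t) (Δ := Δ) hL (x := y) (M := M)
  rw [filling_eq hL ht hΔ hv hv1, filling_eq hL ht hΔ hw hw1]
  have h1 := hv.le_inner hL hv1 w
  have h2 := hw.le_inner hL hw1 v
  rw [re_inner_kitaev, re_inner_kitaev t Δ x (w : Fock L)] at h1
  rw [re_inner_kitaev, re_inner_kitaev t Δ y (v : Fock L)] at h2
  rw [Submodule.coe_norm] at hv1 hw1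
  simp only [Submodule.coe_norm, hv1, hw1] at h1 h2
  nlinarith

/-- By compactness of the unit sphere, ground states at `y → x` converge along an ultrafilter. The
limit is a ground state at `x`, and uniqueness forces its particle number to be the filling there.
-/
theorem continuous_filling (M : ℤ) : Continuous (filling L t Δ M) := by
  have hex := fun x => exists_isGround (t := t) (Δ := Δ) hL (x := x) (M := M)
  choose v hv1 hv using hex
  have hN : Continuous fun w : Fock L => (inner ℂ w (numberOp L w)).re :=
    Complex.continuous_re.comp
      (continuous_id.inner (numberOp L).continuous_of_finiteDimensional)
  have hK : Continuous fun w : Fock L => (inner ℂ w (kitaev L t Δ 0 w)).re :=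
    Complex.continuous_re.comp
      (continuous_id.inner (kitaev L t Δ 0).continuous_of_finiteDimensional)
  have hf : filling L t Δ M = fun x => (inner ℂ (v x : Fock L) (numberOp L (v x))).re :=
    funext fun x => filling_eq hL ht hΔ (hv x) (hv1 x)
  rw [continuous_iff_ultrafilter]
  intro x G hG
  obtain ⟨χ, hχ, hlim⟩ := (isCompact_sphere (0 : Fock L) 1).ultrafilter_le_nhds
    (G.map fun y => (v y : Fock L)) (by
      rw [le_principal_iff, Ultrafilter.coe_map, mem_map]
      exact univ_mem' fun y => mem_sphere_zero_iff_norm.mpr (hv1 y))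
  have hlim : Tendsto (fun y => (v y : Fock L)) G (𝓝 χ) := hlim
  have hχP : χ ∈ paritySector L M :=
    (paritySector L M).closed_of_finiteDimensional.mem_of_tendsto hlim
      (Eventually.of_forall fun y => (v y).2)
  have hχ1 : ‖χ‖ = 1 := by simpa using hχ
  have hx : Tendsto (fun y : ℝ => y) G (𝓝 x) := hG
  have hground : IsGround t Δ x (⟨χ, hχP⟩ : paritySector L M) := by
    have := nontrivial_paritySector hL M
    refine apply_eq_of_inner_le (sectorHam_isSymmetric t Δ x M) ?_
    have h1 : ‖(⟨χ, hχP⟩ : paritySector L M)‖ = 1 := hχ1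
    rw [h1, one_pow, mul_one]
    have h2 := (hv x).inner_kitaev
    rw [hv1, one_pow, mul_one] at h2
    rw [← h2]
    change (inner ℂ χ (kitaev L t Δ x χ)).re ≤ _
    rw [re_inner_kitaev, re_inner_kitaev t Δ x (v x : Fock L)]
    have hleft : Tendsto (fun y => (inner ℂ (v y : Fock L) (kitaev L t Δ 0 (v y))).re
        - y * ((inner ℂ (v y : Fock L) (numberOp L (v y))).re - L / 2 * ‖(v y : Fock L)‖ ^ 2))
        G (𝓝 ((inner ℂ χ (kitaev L t Δ 0 χ)).re
          - x * ((inner ℂ χ (numberOp L χ)).re - L / 2 * ‖χ‖ ^ 2))) :=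
      ((hK.tendsto χ).comp hlim).sub (hx.mul (((hN.tendsto χ).comp hlim).sub
        ((hlim.norm.pow 2).const_mul _)))
    have hright : Tendsto (fun y => (inner ℂ (v x : Fock L) (kitaev L t Δ 0 (v x))).re
        - y * ((inner ℂ (v x : Fock L) (numberOp L (v x))).re - L / 2 * ‖(v x : Fock L)‖ ^ 2))
        G (𝓝 ((inner ℂ (v x : Fock L) (kitaev L t Δ 0 (v x))).re
          - x * ((inner ℂ (v x : Fock L) (numberOp L (v x))).re
            - L / 2 * ‖(v x : Fock L)‖ ^ 2))) :=
      tendsto_const_nhds.sub (hx.mul tendsto_const_nhds)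
    refine le_of_tendsto_of_tendsto' hleft hright fun y => ?_
    rw [← re_inner_kitaev, ← re_inner_kitaev]
    have h3 := (hv y).le_inner hL (hv1 y) (v x)
    rwa [hv1, one_pow, mul_one] at h3
  rw [hf]
  have h4 := hground.inner_number_eq hL ht hΔ (hv x) hχ1 (hv1 x)
  dsimp only
  rw [h4]
  exact (hN.tendsto χ).comp hlim

/-- The shifted chemical potential exists and is unique. -/
theorem existsUnique_isShiftedPotential {𝓔c nc μ : ℝ} {M : ℤ} (h𝓔c : 0 ≤ 𝓔c) (hμ : |μ| < t)
    (hcond : ShiftCondition L t Δ 𝓔c nc μ M) :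
    ∃! μ' : ℝ, IsShiftedPotential L t Δ 𝓔c nc μ M μ' := by
  have hE : 0 ≤ 2 * (𝓔c / L) := by positivity
  have hmono := filling_mono hL ht hΔ M
  have hcont : Continuous fun x => x + 2 * (𝓔c / L) * filling L t Δ M x :=
    continuous_id.add (continuous_const.mul (continuous_filling hL ht hΔ M))
  have hstrict : StrictMono fun x => x + 2 * (𝓔c / L) * filling L t Δ M x := fun x y hxy =>
    add_lt_add_of_lt_of_le hxy (mul_le_mul_of_nonneg_left (hmono hxy.le) hE)
  obtain ⟨hμ1, hμ2⟩ := abs_lt.mp hμ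
  -- Monotonicity carries the hypothesis at `μ` to the endpoints `±t`, where the intermediate value
  -- theorem needs it.
  have hlow : -t + 2 * (𝓔c / L) * filling L t Δ M (-t) < μ + 2 * (𝓔c / L) * (M - 2 * nc) :=
    lt_of_le_of_lt (by gcongr; exact hmono hμ1.le) hcond.1
  have hhigh : μ + 2 * (𝓔c / L) * (M - 2 * nc) < t + 2 * (𝓔c / L) * filling L t Δ M t :=
    lt_of_lt_of_le hcond.2 (by gcongr; exact hmono hμ2.le)
  obtain ⟨y, hy, hy2⟩ := intermediate_value_Ioo (by linarith : -t ≤ t) hcont.continuousOn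
    ⟨hlow, hhigh⟩
  refine ⟨y, ⟨abs_lt.mpr hy, hy2.symm⟩, fun z hz => hstrict.injective ?_⟩
  exact hz.2.symm.trans hy2.symm

end Filling

/-! ### The charging energy as a squared fluctuation, and the gap bound -/

section Charging

variable {L : ℕ}

/-- The full Hamiltonian restricted to states of given parity. -/
def sectorFull (L : ℕ) (t Δ 𝓔c nc μ : ℝ) (M : ℤ) : paritySector L M →ₗ[ℂ] paritySector L M :=
  (kitaev L t Δ μ + chargeOp L 𝓔c nc M).restrict fun v hv =>
    add_mem (bilinear_mem M _ hv) fun S hS => by rw [chargeOp_apply, hv S hS, mul_zero]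

theorem sectorFull_isSymmetric (t Δ 𝓔c nc μ : ℝ) (M : ℤ) : LinearMap.IsSymmetric (𝕜 := ℂ)
    (E := paritySector L M) (sectorFull L t Δ 𝓔c nc μ M) := by
  intro v w
  have h1 := bilinear_isSymmetric (couplings L t Δ μ) (v : Fock L) w
  have h2 : inner ℂ (chargeOp L 𝓔c nc M (v : Fock L)) (w : Fock L) =
      inner ℂ (v : Fock L) (chargeOp L 𝓔c nc M w) := by
    rw [chargeOp, inner_flipOp, ← Finset.bot_eq_empty]
    simp only [symmDiff_bot]
  change inner ℂ (kitaev L t Δ μ (v : Fock L) + chargeOp L 𝓔c nc M (v : Fock L)) (w : Fock L) =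
    inner ℂ (v : Fock L) (kitaev L t Δ μ (w : Fock L) + chargeOp L 𝓔c nc M (w : Fock L))
  rw [inner_add_left, inner_add_right, h2]
  exact congrArg (· + _) h1

theorem ham_embed_coe (t Δ 𝓔c nc μ : ℝ) (M : ℤ) (v : paritySector L M) :
    ham L t Δ 𝓔c nc μ (embed L M v) = embed L M (sectorFull L t Δ 𝓔c nc μ M v) := by
  rw [ham, LinearMap.add_apply, hamZero_embed t Δ μ v.2, charging_embed 𝓔c nc v.2, ← map_add]
  rfl

/-- Completing the square: up to a constant, the full Hamiltonian is the Hamiltonian with shifted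
chemical potential plus a multiple of the squared fluctuation of the particle number. -/
theorem re_inner_sectorFull {t Δ 𝓔c nc μ μ' f : ℝ} {M : ℤ}
    (h : μ + 2 * (𝓔c / L) * (M - 2 * nc) = μ' + 2 * (𝓔c / L) * f) (v : paritySector L M) :
    (inner ℂ v (sectorFull L t Δ 𝓔c nc μ M v)).re =
      (inner ℂ v (sectorHam L t Δ μ' M v)).re
      + 𝓔c / L * ((M - 2 * nc) ^ 2 - f ^ 2 + (f - (M - 2 * nc)) * L) * ‖v‖ ^ 2
      + 𝓔c / L * ‖numberOp L v - (f : ℂ) • (v : Fock L)‖ ^ 2 := by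
  change (inner ℂ (v : Fock L) (kitaev L t Δ μ (v : Fock L) + chargeOp L 𝓔c nc M v)).re =
    (inner ℂ (v : Fock L) (kitaev L t Δ μ' (v : Fock L))).re + _ + _
  rw [inner_add_right, Complex.add_re, re_inner_kitaev, re_inner_kitaev t Δ μ', Submodule.coe_norm,
    EuclideanSpace.norm_sq_eq, EuclideanSpace.norm_sq_eq]
  have h1 : (inner ℂ (v : Fock L) (numberOp L v)).re =
      ∑ S : Finset (Fin L), S.card * ‖(v : Fock L) S‖ ^ 2 := by
    rw [PiLp.inner_apply, Complex.re_sum]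
    refine Finset.sum_congr rfl fun S _ => ?_
    rw [RCLike.inner_apply, numberOp_apply, mul_assoc, Complex.mul_conj, Complex.normSq_eq_norm_sq]
    exact_mod_cast Complex.ofReal_re _
  have h2 : (inner ℂ (v : Fock L) (chargeOp L 𝓔c nc M v)).re =
      ∑ S : Finset (Fin L), 𝓔c / L * (M - S.card - 2 * nc) ^ 2 * ‖(v : Fock L) S‖ ^ 2 := by
    rw [PiLp.inner_apply, Complex.re_sum]
    refine Finset.sum_congr rfl fun S _ => ?_
    rw [RCLike.inner_apply, chargeOp_apply, mul_assoc, Complex.mul_conj,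
      Complex.normSq_eq_norm_sq, ← Complex.ofReal_mul, Complex.ofReal_re]
  have h3 : ∀ S : Finset (Fin L), ‖(numberOp L v - (f : ℂ) • (v : Fock L)) S‖ ^ 2 =
      (S.card - f) ^ 2 * ‖(v : Fock L) S‖ ^ 2 := by
    intro S
    have : (numberOp L v - (f : ℂ) • (v : Fock L)) S =
        ((S.card - f : ℝ) : ℂ) * (v : Fock L) S := by
      rw [PiLp.sub_apply, PiLp.smul_apply, numberOp_apply, smul_eq_mul]
      push_cast
      ring
    rw [this, norm_mul, mul_pow, Complex.norm_real, Real.norm_eq_abs, sq_abs]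
  -- With `m = M - 2 nc` and `n = |S|`, `(m - n)² = (n - f)² + 2 n (f - m) + m² - f²`. The term
  -- linear in `n` replaces `μ` by `μ'`; the part `(f - m) L` of the constant compensates for the
  -- offset `L/2`.
  have key : -(μ * (∑ S : Finset (Fin L), S.card * ‖(v : Fock L) S‖ ^ 2 -
        L / 2 * ∑ S, ‖(v : Fock L) S‖ ^ 2)) +
      ∑ S : Finset (Fin L), 𝓔c / L * (M - S.card - 2 * nc) ^ 2 * ‖(v : Fock L) S‖ ^ 2 =
      -(μ' * (∑ S : Finset (Fin L), S.card * ‖(v : Fock L) S‖ ^ 2 -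
        L / 2 * ∑ S, ‖(v : Fock L) S‖ ^ 2)) +
      𝓔c / L * ((M - 2 * nc) ^ 2 - f ^ 2 + (f - (M - 2 * nc)) * L) *
        ∑ S, ‖(v : Fock L) S‖ ^ 2 +
      𝓔c / L * ∑ S : Finset (Fin L), (S.card - f) ^ 2 * ‖(v : Fock L) S‖ ^ 2 := by
    simp only [Finset.mul_sum, ← Finset.sum_sub_distrib, ← Finset.sum_neg_distrib,
      ← Finset.sum_add_distrib]
    refine Finset.sum_congr rfl fun S _ => ?_
    linear_combination (-(S.card * ‖(v : Fock L) S‖ ^ 2) + L / 2 * ‖(v : Fock L) S‖ ^ 2) * h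
  rw [h1, h2]
  simp only [h3]
  linarith [key]

/-- The variance is the least second moment. -/
theorem norm_sub_inner_smul_le {E : Type*} [NormedAddCommGroup E] [InnerProductSpace ℂ E] {v w : E}
    (hv : ‖v‖ = 1) (c : ℝ) :
    ‖w - (((inner ℂ v w).re : ℝ) : ℂ) • v‖ ^ 2 ≤ ‖w - (c : ℂ) • v‖ ^ 2 := by
  have key : ∀ d : ℝ, ‖w - (d : ℂ) • v‖ ^ 2 = ‖w‖ ^ 2 - 2 * d * (inner ℂ v w).re + d ^ 2 := by
    intro d
    have h1 := norm_sub_sq (𝕜 := ℂ) w ((d : ℂ) • v)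
    rw [h1, inner_smul_right, norm_smul, hv, mul_one, Complex.norm_real, Real.norm_eq_abs, sq_abs]
    have h2 : RCLike.re ((d : ℂ) * inner ℂ w v) = d * (inner ℂ v w).re := by
      rw [← inner_conj_symm w v]
      change ((d : ℂ) * conj (inner ℂ v w)).re = _
      rw [Complex.re_ofReal_mul, Complex.conj_re]
    rw [h2]
    ring
  rw [key, key]
  nlinarith [sq_nonneg (c - (inner ℂ v w).re)]

theorem gap_sub_le_gap_ham {t Δ 𝓔c nc μ μ' : ℝ} {M : ℤ} (hL : 2 ≤ L) (ht : 0 < t) (hΔ : Δ ≠ 0)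
    (h𝓔c : 0 ≤ 𝓔c) (hμ' : IsShiftedPotential L t Δ 𝓔c nc μ M μ') :
    gap (hamZero L t Δ μ') M - 𝓔c / 2 ≤ gap (ham L t Δ 𝓔c nc μ) M := by
  obtain ⟨v, hv1, hv⟩ := exists_isGround (t := t) (Δ := Δ) hL (x := μ') (M := M)
  have hf := filling_eq hL ht hΔ hv hv1
  have hE : 0 ≤ 𝓔c / L := by positivity
  have hL0 : (0 : ℝ) < L := by positivity
  simp only [gap, level_eq_spectralLevel (hamZero_embed_coe t Δ μ' M),
    level_eq_spectralLevel (ham_embed_coe t Δ 𝓔c nc μ M)]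
  set f := filling L t Δ M μ' with hfdef
  refine gap_sub_le_gap (sectorHam_isSymmetric t Δ μ' M) (sectorFull_isSymmetric t Δ 𝓔c nc μ M)
    (one_lt_finrank_paritySector hL M)
    (c := 𝓔c / L * ((M - 2 * nc) ^ 2 - f ^ 2 + (f - (M - 2 * nc)) * L)) hv1 (fun w => ?_) ?_
  · rw [re_inner_sectorFull hμ'.2 w]
    have : 0 ≤ 𝓔c / L * ‖numberOp L w - (f : ℂ) • (w : Fock L)‖ ^ 2 := by positivity
    linarith
  · have hground : (inner ℂ v (sectorHam L t Δ μ' M v)).re =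
        spectralLevel (E := paritySector L M) (sectorHam L t Δ μ' M) 0 := by
      have := hv.inner_kitaev
      rwa [hv1, one_pow, mul_one] at this
    rw [re_inner_sectorFull hμ'.2 v, hground, hv1, one_pow, mul_one]
    obtain ⟨c, hc⟩ := hv.norm_number_sub_sq_le hL ht hΔ hv1
    -- The filling is the mean of `N_w` in `v`, so it does at least as well as the centre `c` of the
    -- fluctuation bound.
    have hvar : ‖numberOp L v - (f : ℂ) • (v : Fock L)‖ ^ 2 ≤ L / 2 := by
      have hv1' : ‖(v : Fock L)‖ = 1 := hv1
      have hmin := norm_sub_inner_smul_le (w := numberOp L (v : Fock L)) hv1' c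
      rw [← hf] at hmin
      exact hmin.trans hc
    have : 𝓔c / L * ‖numberOp L v - (f : ℂ) • (v : Fock L)‖ ^ 2 ≤ 𝓔c / 2 := by
      calc _ ≤ 𝓔c / L * (L / 2) := mul_le_mul_of_nonneg_left hvar hE
        _ = 𝓔c / 2 := by field_simp
    linarith

theorem hasUniqueGroundState_ham {t Δ 𝓔c nc μ : ℝ} {M : ℤ} (hL : 2 ≤ L)
    (h : 0 < gap (ham L t Δ 𝓔c nc μ) M) : HasUniqueGroundState (ham L t Δ 𝓔c nc μ) M := by
  have := nontrivial_paritySector hL M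
  have h1 : spectralLevel (E := paritySector L M) (sectorFull L t Δ 𝓔c nc μ M) 0 <
      spectralLevel (E := paritySector L M) (sectorFull L t Δ 𝓔c nc μ M) 1 := by
    rw [← level_eq_spectralLevel (ham_embed_coe t Δ 𝓔c nc μ M),
      ← level_eq_spectralLevel (ham_embed_coe t Δ 𝓔c nc μ M)]
    exact sub_pos.mp h
  exact (finrank_groundSpace (ham_embed_coe t Δ 𝓔c nc μ M)).trans
    (finrank_eigenspace_eq_one (E := paritySector L M) (sectorFull_isSymmetric t Δ 𝓔c nc μ M) h1)

end Charging

end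

end NumberConservingWire

theorem theorem3 (L : ℕ) (hL : 2 ≤ L) (t Δ 𝓔c nc μ : ℝ) (M : ℤ)
    (hΔ : Δ ≠ 0) (h𝓔c : 0 ≤ 𝓔c) (hμ : |μ| < t)
    (hcond : NumberConservingWire.ShiftCondition L t Δ 𝓔c nc μ M) :
    (∃! μ' : ℝ, NumberConservingWire.IsShiftedPotential L t Δ 𝓔c nc μ M μ') ∧
    ∀ μ' : ℝ, NumberConservingWire.IsShiftedPotential L t Δ 𝓔c nc μ M μ' →
      (𝓔c * (1 / 2 + 8 / L) <
          NumberConservingWire.gap (NumberConservingWire.hamZero L t Δ μ') M →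
        NumberConservingWire.HasUniqueGroundState
            (NumberConservingWire.ham L t Δ 𝓔c nc μ) M ∧
          NumberConservingWire.gap (NumberConservingWire.hamZero L t Δ μ') M
              - 𝓔c * (1 / 2 + 8 / L) ≤
            NumberConservingWire.gap (NumberConservingWire.ham L t Δ 𝓔c nc μ) M) ∧
      (Even M →
        𝓔c / 2 < NumberConservingWire.gap (NumberConservingWire.hamZero L t Δ μ') M →
        NumberConservingWire.HasUniqueGroundState
            (NumberConservingWire.ham L t Δ 𝓔c nc μ) M ∧
          NumberConservingWire.gap (NumberConservingWire.hamZero L t Δ μ') M - 𝓔c / 2 ≤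
            NumberConservingWire.gap (NumberConservingWire.ham L t Δ 𝓔c nc μ) M) := by
  have ht : 0 < t := (abs_nonneg μ).trans_lt hμ
  refine ⟨NumberConservingWire.existsUnique_isShiftedPotential hL ht hΔ h𝓔c hμ hcond,
    fun μ' hμ' => ?_⟩
  have hgap := NumberConservingWire.gap_sub_le_gap_ham hL ht hΔ h𝓔c hμ'
  refine ⟨fun h => ?_, fun _ h =>
    ⟨NumberConservingWire.hasUniqueGroundState_ham hL (by linarith), hgap⟩⟩
  -- The loss allowed in (a) exceeds the proven one by the nonnegative term `𝓔c * (8 / L)`.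
  have h8 : 𝓔c / 2 ≤ 𝓔c * (1 / 2 + 8 / L) := by
    have : 0 ≤ 𝓔c * (8 / L) := by positivity
    linarith
  exact ⟨NumberConservingWire.hasUniqueGroundState_ham hL (by linarith), by linarith⟩
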